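/- Let $N,K\ge 0$ and $m\ge 0$ be integers, let $A=(a_{ij})\in\mathbb R^{K\times K}$ and $b=(b_1,\dots,b_K)\in\mathbb R^K$. **Trees.** A labelled tree is a pair $(V,E)$ consisting of a finite nonempty set $V\subset\mathbb Z$ of vertices and a set $E\subset\{(x,y)\in V\times V: x<y\}$ of edges such that every vertex $y$ has at most one $x$ with $(x,y)\in E$, and for any two distinct vertices $x,y$ there is a directed path from $x$ to $y$, or from $y$ to $x$, or there is a third vertex from which there are directed paths to both. Let $T$ be the set of isomorphism classes of labelled trees, that is, of finite rooted trees. Let $\tau$ be the tree with one vertex, and for $l\ge 1$ let $[t_1\cdots t_l]$ be the tree obtained by joining a new root to the roots of $t_1,\dots,t_l$ (the order of the $t_k$ is irrelevant); $\tau$ is regarded as the case $l=0$. For $t\in T$ let $r(t)$ be its number of vertices, let $\alpha(t)$ be the number of labelled trees with vertex set $\{1,\dots,r(t)\}$ in the class $t$, and put $\sigma(\tau)=1$ and $$\sigma([t_1^{m_1}\cdots t_l^{m_l}])=\prod_{i=1}^l m_i!\,\sigma(t_i)^{m_i}$$ for pairwise distinct $t_1,\dots,t_l$ occurring with multiplicities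 $m_1,\dots,m_l$. For $i=1,\dots,K$ put $$\zeta_i([t_1\cdots t_l];A)=\sum_{j=1}^K a_{ij}\prod_{k=1}^l\zeta_j(t_k;A),$$ where an empty product is $1$, so that $\zeta_i(\tau;A)=\sum_{j=1}^K a_{ij}$. **Order conditions.** $(A,b)$ satisfies the $m$-th order conditions if $$\frac{\alpha(t)}{r(t)!}=\frac{\sum_{i=1}^K b_i\prod_{k=1}^l\zeta_i(t_k;A)}{\sigma(t)}$$ for every $t=[t_1\cdots t_l]\in T$, $l\ge 0$, with $r(t)\le m$. **Integration schemes.** Let $C_b^\infty(\mathbb R^N;\mathbb R^N)$ be the set of smooth maps that are bounded together with all their derivatives. For $W$ in this set, let $\exp(W)(x)$ be the value at time $1$ of the solution of $\frac{dz_t}{dt}=W(z_t)$, $z_0=x$, and let $$\|W\|_{C^n}=\sum_{i=0}^n\sup\{|W^{(i)}_{(x)}(U_1,\dots,U_i)| : x\in\mathbb R^N,\ |U_1|=\dots=|U_i|=1\},$$ where $W^{(i)}$ is the $i$-th total differential of $W$. A map $g$ from $C_b^\infty(\mathbb R^N;\mathbb R^N)$ to the set of maps $\mathbb R^N\to\mathbb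 R^N$ is an integration scheme of order $m$ if there is a constant $C>0$ such that $$\sup_{x\in\mathbb R^N}|g(W)(x)-\exp(W)(x)|\le C\,\|W\|_{C^{m+1}}^{m+1}\quad\text{for all } W\in C_b^\infty(\mathbb R^N;\mathbb R^N).$$ **Theorem.** Suppose that $(A,b)$ satisfies the $m$-th order conditions. Let $g(W)(y_0)=Y(y_0;W,1)$ be given by the Runge–Kutta method with coefficients $(A,b)$ and step $s=1$, that is, for all $W\in C_b^\infty(\mathbb R^N;\mathbb R^N)$ and $y_0\in\mathbb R^N$, $$g(W)(y_0)=y_0+\sum_{i=1}^K b_iW(Y_i)\quad\text{for some } Y_1,\dots,Y_K\in\mathbb R^N \text{ with } Y_i=y_0+\sum_{j=1}^K a_{ij}W(Y_j),\quad i=1,\dots,K$$ (if the method is implicit and this system has several solutions, any choice of a solution is allowed). Then $g$ is an integration scheme of order $m$. -/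

import Mathlib

open scoped ContDiff Nat

noncomputable section

namespace RK

/-! ### Unlabelled rooted trees -/

/-- `Multiset` is a quotient of the polynomial functor `X ↦ Σ n, Xⁿ`. -/
instance multisetQPF : QPF Multiset where
  toFunctor := Multiset.functor
  P := ⟨ℕ, Fin⟩
  abs := fun p => (List.ofFn p.2 : Multiset _)
  repr := fun s => ⟨s.toList.length, s.toList.get⟩
  abs_repr := fun s => by
    change ((List.ofFn s.toList.get : List _) : Multiset _) = s
    rw [List.ofFn_get, Multiset.coe_toList]
  abs_map := fun f p => by
    obtain ⟨n, x⟩ := p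
    change ((List.ofFn (f ∘ x) : List _) : Multiset _) = Multiset.map f (List.ofFn x : List _)
    rw [Multiset.map_coe, List.map_ofFn]

/-- The set `T` of unlabelled (finite) rooted trees, i.e. the least type closed under forming a tree
`[t₁ ⋯ tₗ]` from a finite multiset of trees `t₁, …, tₗ` (`l = 0` gives the one-vertex tree `τ`). -/
def RTree : Type := QPF.Fix Multiset

namespace RTree

/-- The tree `[t₁ ⋯ tₗ]`: a new root joined to the roots of `t₁, …, tₗ`. -/
def node (s : Multiset RTree) : RTree := QPF.Fix.mk s

/-- The multiset `t₁, …, tₗ` of branches of `t = [t₁ ⋯ tₗ]`. -/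
def branches (t : RTree) : Multiset RTree := QPF.Fix.dest t

/-- Recursion on rooted trees. -/
def fold {α : Type} (g : Multiset α → α) (t : RTree) : α := QPF.Fix.rec g t

theorem branches_node (s : Multiset RTree) : (node s).branches = s := QPF.Fix.dest_mk s

theorem node_branches (t : RTree) : node t.branches = t := QPF.Fix.mk_dest t

theorem fold_node {α : Type} (g : Multiset α → α) (s : Multiset RTree) :
    fold g (node s) = g (s.map (fold g)) := QPF.Fix.rec_eq g s

theorem induction {p : RTree → Prop} (h : ∀ s : Multiset RTree, (∀ t ∈ s, p t) → p (node s))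
    (t : RTree) : p t := by
  refine QPF.Fix.ind p (fun s hs => h s ?_) t
  obtain ⟨u, rfl⟩ := hs
  intro t ht
  obtain ⟨a, -, rfl⟩ := Multiset.mem_map.1 ht
  exact a.2

/-- The number `r(t)` of vertices. -/
def order (t : RTree) : ℕ := fold (fun s => 1 + s.sum) t

theorem order_node (s : Multiset RTree) : (node s).order = 1 + (s.map order).sum :=
  fold_node _ s

open Classical in
/-- Recursion for `t ↦ (t, σ(t))`. -/
def symmetryAux (t : RTree) : RTree × ℕ :=
  fold (fun s : Multiset (RTree × ℕ) =>
    (node (s.map Prod.fst), ∏ p ∈ s.toFinset, (s.count p)! * p.2 ^ s.count p)) t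

/-- The symmetry `σ(t)`; see `symmetry_node` for its recursion. -/
def symmetry (t : RTree) : ℕ := (symmetryAux t).2

theorem symmetryAux_fst (t : RTree) : (symmetryAux t).1 = t := by
  refine induction (p := fun t => (symmetryAux t).1 = t) (fun s hs => ?_) t
  rw [symmetryAux, fold_node]
  simp only [Multiset.map_map, Function.comp_def]
  congr 1
  exact (Multiset.map_congr rfl hs).trans (Multiset.map_id _)

open Classical in
/-- `σ([t₁^{m₁} ⋯ tₗ^{mₗ}]) = ∏ mᵢ! σ(tᵢ)^{mᵢ}` for pairwise distinct `t₁, …, tₗ`. -/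
theorem symmetry_node (s : Multiset RTree) :
    (node s).symmetry = ∏ t ∈ s.toFinset, (s.count t)! * t.symmetry ^ s.count t := by
  have hinj : Function.Injective symmetryAux := fun a b h => by
    rw [← symmetryAux_fst a, ← symmetryAux_fst b, h]
  have h : (node s).symmetry = ∏ p ∈ (s.map symmetryAux).toFinset,
      ((s.map symmetryAux).count p)! * p.2 ^ (s.map symmetryAux).count p := by
    rw [symmetry, symmetryAux, fold_node]
    rfl
  rw [h, Multiset.toFinset_map, Finset.prod_image (fun a _ b _ hab => hinj hab)]
  refine Finset.prod_congr rfl fun t _ => ?_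
  rw [Multiset.count_map_eq_count' _ _ hinj]
  rfl

/-- The derivative weights `ζᵢ(t; A)`; see `weight_node` for their recursion. -/
def weight {K : ℕ} (A : Matrix (Fin K) (Fin K) ℝ) (t : RTree) : Fin K → ℝ :=
  fold (fun s : Multiset (Fin K → ℝ) => fun i => ∑ j, A i j * (s.map fun z => z j).prod) t

/-- `ζᵢ([t₁ ⋯ tₗ]; A) = ∑ⱼ aᵢⱼ ∏ₖ ζⱼ(tₖ; A)`. -/
theorem weight_node {K : ℕ} (A : Matrix (Fin K) (Fin K) ℝ) (s : Multiset RTree) (i : Fin K) :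
    weight A (node s) i = ∑ j, A i j * (s.map fun t => weight A t j).prod := by
  rw [weight, fold_node]
  simp only [Multiset.map_map, Function.comp_def]
  rfl

end RTree

/-! ### Labelled trees -/

/-- A labelled tree: a finite nonempty set of integers as vertices, and edges that increase. -/
structure LTree where
  V : Finset ℤ
  E : Finset (ℤ × ℤ)
  nonempty : V.Nonempty
  edge_mem : ∀ e ∈ E, e.1 ∈ V ∧ e.2 ∈ V ∧ e.1 < e.2
  parent_unique : ∀ x x' y : ℤ, (x, y) ∈ E → (x', y) ∈ E → x = x'
  connected : ∀ x ∈ V, ∀ y ∈ V, x ≠ y →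
    Relation.TransGen (fun a b => (a, b) ∈ E) x y ∨
    Relation.TransGen (fun a b => (a, b) ∈ E) y x ∨
    ∃ z ∈ V, z ≠ x ∧ z ≠ y ∧ Relation.TransGen (fun a b => (a, b) ∈ E) z x ∧
      Relation.TransGen (fun a b => (a, b) ∈ E) z y

namespace LTree

/-- The children of a vertex. -/
def children (u : LTree) (x : ℤ) : Finset ℤ := u.V.filter fun y => (x, y) ∈ u.E

/-- The unlabelled rooted tree formed by `x` and the vertices that can be reached from `x`. -/
def shapeAt (u : LTree) (x : ℤ) : RTree :=
  RTree.node ((u.children x).attach.val.map fun y => shapeAt u y.1)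
termination_by (u.V.filter fun z => x < z).card
decreasing_by
  have hy := Finset.mem_filter.1 y.2
  have hlt : x < y.1 := (u.edge_mem _ hy.2).2.2
  refine Finset.card_lt_card (Finset.ssubset_iff_subset_ne.2 ⟨fun z hz => ?_, fun h => ?_⟩)
  · rw [Finset.mem_filter] at hz ⊢
    exact ⟨hz.1, hlt.trans hz.2⟩
  · have hmem : y.1 ∈ u.V.filter fun z => x < z := Finset.mem_filter.2 ⟨hy.1, hlt⟩
    rw [← h] at hmem
    exact lt_irrefl _ (Finset.mem_filter.1 hmem).2

/-- The root; since edges increase, it is the least vertex. -/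
def root (u : LTree) : ℤ := u.V.min' u.nonempty

/-- The unlabelled tree `|u|` that a labelled tree `u` represents. -/
def shape (u : LTree) : RTree := u.shapeAt u.root

end LTree

/-- `α(t)`: the number of labelled trees with vertex set `{1, …, r(t)}` that represent `t`. -/
def RTree.labellings (t : RTree) : ℕ :=
  Nat.card {u : LTree // u.V = Finset.Icc 1 (t.order : ℤ) ∧ u.shape = t}

/-- The `m`-th order conditions on the Runge–Kutta coefficients `(A, b)`. -/
def OrderConditions {K : ℕ} (m : ℕ) (A : Matrix (Fin K) (Fin K) ℝ) (b : Fin K → ℝ) : Prop :=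
  ∀ t : RTree, t.order ≤ m →
    (t.labellings : ℝ) / (t.order ! : ℝ) =
      (∑ i, b i * (t.branches.map fun s => s.weight A i).prod) / (t.symmetry : ℝ)

/-! ### Vector fields, flows and integration schemes -/

/-- `C_b^∞(ℝ^N; ℝ^N)`: smooth maps all of whose derivatives (of order `≥ 0`) are bounded. -/
structure SmoothBdd (N : ℕ) where
  toFun : EuclideanSpace ℝ (Fin N) → EuclideanSpace ℝ (Fin N)
  contDiff : ContDiff ℝ ∞ toFun
  bounded : ∀ n : ℕ, ∃ C : ℝ, ∀ x, ‖iteratedFDeriv ℝ n toFun x‖ ≤ C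

instance {N : ℕ} : CoeFun (SmoothBdd N)
    (fun _ => EuclideanSpace ℝ (Fin N) → EuclideanSpace ℝ (Fin N)) := ⟨SmoothBdd.toFun⟩

namespace SmoothBdd

variable {N : ℕ}

/-- `‖W^{(n)}‖`. -/
def derivNorm (W : SmoothBdd N) (n : ℕ) : ℝ :=
  sSup {c : ℝ | ∃ (x : EuclideanSpace ℝ (Fin N)) (U : Fin n → EuclideanSpace ℝ (Fin N)),
    (∀ i, ‖U i‖ = 1) ∧ c = ‖iteratedFDeriv ℝ n W x U‖}

/-- `‖W‖_{C^n}`. -/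
def cNorm (W : SmoothBdd N) (n : ℕ) : ℝ := ∑ i ∈ Finset.range (n + 1), W.derivNorm i

/-- `z` solves `dz/dt = W(z)`, `z(0) = x` on `[0, 1]`. -/
def IsSolution (W : SmoothBdd N) (x : EuclideanSpace ℝ (Fin N))
    (z : ℝ → EuclideanSpace ℝ (Fin N)) : Prop :=
  z 0 = x ∧ ∀ t ∈ Set.Icc (0 : ℝ) 1, HasDerivWithinAt z (W (z t)) (Set.Icc 0 1) t

theorem exists_lipschitz (W : SmoothBdd N) : ∃ L : NNReal, LipschitzWith L W := by
  obtain ⟨C, hC⟩ := W.bounded 1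
  refine ⟨C.toNNReal, lipschitzWith_of_nnnorm_fderiv_le
    (W.contDiff.differentiable (by simp)) fun x => ?_⟩
  rw [← NNReal.coe_le_coe, coe_nnnorm, ← norm_iteratedFDeriv_one]
  exact (hC x).trans (Real.le_coe_toNNReal C)

theorem exists_solution (W : SmoothBdd N) (x : EuclideanSpace ℝ (Fin N)) :
    ∃ z, W.IsSolution x z := by
  obtain ⟨C, hC⟩ := W.bounded 0
  obtain ⟨L, hL⟩ := W.exists_lipschitz
  have h : IsPicardLindelof (fun _ : ℝ => W.toFun)
      (⟨0, by simp⟩ : Set.Icc (0 : ℝ) 1) x C.toNNReal 0 C.toNNReal L :=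
    { lipschitzOnWith := fun _ _ => hL.lipschitzOnWith
      continuousOn := fun _ _ => continuousOn_const
      norm_le := fun _ _ y _ => by
        have := hC y
        rw [norm_iteratedFDeriv_zero] at this
        exact this.trans (Real.le_coe_toNNReal C)
      mul_max_le := by simp }
  exact h.exists_eq_forall_mem_Icc_hasDerivWithinAt₀

theorem IsSolution.unique {W : SmoothBdd N} {x : EuclideanSpace ℝ (Fin N)}
    {z z' : ℝ → EuclideanSpace ℝ (Fin N)} (h : W.IsSolution x z) (h' : W.IsSolution x z') :
    z 1 = z' 1 := by
  obtain ⟨L, hL⟩ := W.exists_lipschitz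
  have key : ∀ {z : ℝ → EuclideanSpace ℝ (Fin N)}, W.IsSolution x z →
      ContinuousOn z (Set.Icc 0 1) ∧
        ∀ t ∈ Set.Ico (0 : ℝ) 1, HasDerivWithinAt z (W (z t)) (Set.Ici t) t := fun hz =>
    ⟨fun t ht => (hz.2 t ht).continuousWithinAt, fun t ht =>
      (hz.2 t (Set.Ico_subset_Icc_self ht)).mono_of_mem_nhdsWithin
        (Icc_mem_nhdsGE_of_mem ht)⟩
  exact ODE_solution_unique_of_mem_Icc_right (v := fun _ => W.toFun) (s := fun _ => Set.univ)
    (fun _ _ => hL.lipschitzOnWith) (key h).1 (key h).2 (fun _ _ => trivial)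
    (key h').1 (key h').2 (fun _ _ => trivial) (h.1.trans h'.1.symm) (by simp)

/-- `exp(W)(x)`: the value at time `1` of the solution of `dz/dt = W(z)`, `z(0) = x`. -/
def exp (W : SmoothBdd N) (x : EuclideanSpace ℝ (Fin N)) : EuclideanSpace ℝ (Fin N) :=
  (W.exists_solution x).choose 1

theorem IsSolution.eq_exp {W : SmoothBdd N} {x : EuclideanSpace ℝ (Fin N)}
    {z : ℝ → EuclideanSpace ℝ (Fin N)} (h : W.IsSolution x z) : z 1 = W.exp x :=
  h.unique (W.exists_solution x).choose_spec

end SmoothBdd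

/-- `g` is an integration scheme of order `m`. -/
def IsIntegrationScheme {N : ℕ} (m : ℕ)
    (g : SmoothBdd N → EuclideanSpace ℝ (Fin N) → EuclideanSpace ℝ (Fin N)) : Prop :=
  ∃ C : ℝ, 0 < C ∧ ∀ (W : SmoothBdd N) (x : EuclideanSpace ℝ (Fin N)),
    ‖g W x - W.exp x‖ ≤ C * W.cNorm (m + 1) ^ (m + 1)

/-- `y` is a value `Y(y₀; W, s)` of the Runge–Kutta method `(A, b)`: for some solution `Y₁, …, Y_K`
of the (in general implicit) stage equations `Yᵢ = y₀ + s ∑ⱼ aᵢⱼ W(Yⱼ)`, one has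
`y = y₀ + s ∑ᵢ bᵢ W(Yᵢ)`. -/
def IsRungeKuttaValue {N K : ℕ} (A : Matrix (Fin K) (Fin K) ℝ) (b : Fin K → ℝ) (W : SmoothBdd N)
    (s : ℝ) (y₀ y : EuclideanSpace ℝ (Fin N)) : Prop :=
  ∃ Y : Fin K → EuclideanSpace ℝ (Fin N),
    (∀ i, Y i = y₀ + s • ∑ j, A i j • W (Y j)) ∧ y = y₀ + s • ∑ i, b i • W (Y i)

end RK

end

noncomputable section

namespace RK

/-! ### Tuples with a prescribed multiset of values -/

/-! Write M for the `C^{m+1}` norm of `W` and F(t) for the elementary differential of a tree t at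
the initial point x. Each vertex of t contributes one derivative of `W`, so F(t) is O(M^{r(t)}). The
exact flow and the Runge–Kutta value both expand as x plus a combination of the F(t) with r(t) ≤ m.
When M ≤ 1 the remainders are O(M^{m+1}), uniformly in `W` and x, and the order conditions say
exactly that the coefficients agree.

For the flow, differentiating F of a labelled tree along a solution gives, by the product and chain
rules, the sum over all ways to attach a new leaf (`hasDerivWithinAt_elemDiff_shape`). Every
labelled tree on {1, …, n+1} arises exactly once in this way from one on {1, …, n}
(`sum_labelled_succ`). Hence the k-th derivative of the solution is the sum of F over labelled trees
with k vertices, and Taylor's formula produces the coefficients α(t)/r(t)! (`norm_exp_sub_le`).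

For the method, an expansion of the stages up to order q is inserted into the Taylor polynomial of
`W`, which yields one of `W` at the stages up to order q+1 (`exists_norm_map_add_sub_le`). The stage
equations turn this into an expansion of the stages up to order q+1. The factor 1/k! in Taylor's
formula and the number of orderings of k branches combine to the factorials in σ(t). The bootstrap
starts from the trivial bound `Y i` − x = O(M), so it holds for every solution of the implicit
system, with no smallness or uniqueness assumption.

If M ≥ 1, both increments are O(M), which is already O(M^{m+1}). -/

/-- Corresponding fibres have equal cardinality, and bijections between them glue to a permutation.
-/
theorem exists_perm_of_map_univ_eq {α : Type*} {k : ℕ} {f g : Fin k → α}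
    (h : (Finset.univ.val.map f : Multiset α) = Finset.univ.val.map g) :
    ∃ σ : Equiv.Perm (Fin k), g ∘ σ = f := by
  classical
  have hc : ∀ c, Fintype.card {a // f a = c} = Fintype.card {a // g a = c} := fun c => by
    have := congrArg (Multiset.count c) h
    rw [Multiset.count_map, Multiset.count_map] at this
    rw [Fintype.card_subtype, Fintype.card_subtype]
    simpa [Finset.card_def, Finset.filter_val, eq_comm] using this
  refine ⟨Equiv.ofFiberEquiv fun c => Fintype.equivOfCardEq (hc c), ?_⟩
  funext a
  exact Equiv.ofFiberEquiv_map _ a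

theorem exists_map_univ_eq {α : Type*} {k : ℕ} {s : Multiset α} (hs : s.card = k) :
    ∃ f : Fin k → α, Finset.univ.val.map f = s := by
  subst hs
  induction s using Multiset.induction with
  | empty => exact ⟨Fin.elim0, rfl⟩
  | cons a s ih =>
    obtain ⟨f, hf⟩ := ih
    rw [Multiset.card_cons]
    refine ⟨Fin.cons a f, ?_⟩
    rw [Fin.univ_val_map, List.ofFn_cons, ← Multiset.cons_coe, ← Fin.univ_val_map, hf]

open Classical in
/-- The number of tuples with a given multiset of values is a multinomial coefficient. -/
theorem card_tuples_mul_prod_factorial {α : Type*} {k : ℕ} {s : Multiset α} (hs : s.card = k)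
    {S : Finset α} (hS : ∀ a ∈ s, a ∈ S) :
    ((Fintype.piFinset fun _ : Fin k => S).filter
      fun f => Finset.univ.val.map f = s).card * ∏ a ∈ s.toFinset, (s.count a)! = k ! := by
  obtain ⟨f, rfl⟩ := exists_map_univ_eq hs
  have hcount : ∀ a, (Finset.univ.val.map f).count a = Fintype.card {i // f i = a} := fun a => by
    rw [Multiset.count_map, Fintype.card_subtype]
    simp [Finset.card_def, Finset.filter_val, eq_comm]
  have hstab : Fintype.card {σ : Equiv.Perm (Fin k) // f ∘ σ = f} =
      ∏ a ∈ (Finset.univ.val.map f).toFinset, ((Finset.univ.val.map f).count a)! := by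
    rw [DomMulAct.stabilizer_card']
    simp only [hcount]
    rfl
  -- Orbit–stabiliser count: `σ ↦ f ∘ σ` maps the `k !` permutations onto the admissible tuples, and
  -- each fibre is a coset of the stabiliser of `f`.
  have hfib := Finset.card_eq_sum_card_fiberwise (s := (Finset.univ : Finset (Equiv.Perm (Fin k))))
    (t := (Fintype.piFinset fun _ : Fin k => S).filter
      fun g => (Finset.univ.val.map g : Multiset α) = Finset.univ.val.map f)
    (f := fun σ : Equiv.Perm (Fin k) => f ∘ σ) (fun σ _ => by
      simp only [Finset.coe_filter, Fintype.mem_piFinset, Set.mem_ofPred_eq]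
      refine ⟨fun i => hS _ (Multiset.mem_map_of_mem _ (Finset.mem_univ_val _)), ?_⟩
      rw [Fin.univ_val_map, Fin.univ_val_map]
      exact Quotient.sound (σ.ofFn_comp_perm f))
  rw [Finset.card_univ, Fintype.card_perm, Fintype.card_fin] at hfib
  rw [hfib, ← hstab, Finset.sum_const_nat]
  intro g hg
  obtain ⟨σ, rfl⟩ := exists_perm_of_map_univ_eq (Finset.mem_filter.1 hg).2
  rw [← Fintype.card_subtype]
  refine Fintype.card_congr ((Equiv.mulRight σ⁻¹).subtypeEquiv fun ρ => ?_)
  simp only [Equiv.coe_mulRight, Equiv.Perm.coe_mul]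
  constructor
  · intro h
    rw [← Function.comp_assoc, h, Function.comp_assoc, ← Equiv.Perm.coe_mul, mul_inv_cancel]
    rfl
  · intro h
    conv_rhs => rw [← h]
    rw [Function.comp_assoc, Function.comp_assoc, ← Equiv.Perm.coe_mul, inv_mul_cancel]
    rfl

namespace RTree

/-! ### Trees of bounded order -/

theorem order_eq (t : RTree) : t.order = 1 + (t.branches.map order).sum := by
  conv_lhs => rw [← node_branches t]
  exact order_node _

theorem order_pos (t : RTree) : 0 < t.order := by
  rw [order_eq]; omega

theorem order_lt_of_mem_branches {t t' : RTree} (h : t' ∈ t.branches) : t'.order < t.order := by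
  rw [order_eq t]
  have := Multiset.single_le_sum (fun _ _ => Nat.zero_le _) _ (Multiset.mem_map_of_mem order h)
  omega

theorem card_le_sum_order (s : Multiset RTree) : s.card ≤ (s.map order).sum := by
  have := Multiset.card_nsmul_le_sum (s := s.map order) (a := 1) (fun x hx => by
    obtain ⟨t, -, rfl⟩ := Multiset.mem_map.1 hx
    exact t.order_pos)
  simpa using this

theorem card_branches_lt_order (t : RTree) : t.branches.card < t.order := by
  rw [order_eq t]
  have := card_le_sum_order t.branches
  omega

/-- A tree of order at most n+1 has at most n branches, each of order at most n, so it is the image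
of one of finitely many tuples. -/
theorem finite_order_le (n : ℕ) : {t : RTree | t.order ≤ n}.Finite := by
  induction n with
  | zero =>
    convert Set.finite_empty
    ext t
    simpa using t.order_pos.ne'
  | succ n ih =>
    have hfin : (⋃ k ∈ Finset.range (n + 1), Set.range fun f : Fin k → ih.toFinset =>
        node (Finset.univ.val.map fun i => (f i : RTree))).Finite :=
      Set.Finite.biUnion (Finset.finite_toSet _) fun k _ => Set.finite_range _
    refine hfin.subset fun t ht => ?_
    have ht' : t.order ≤ n + 1 := ht
    have hcard := t.card_branches_lt_order
    obtain ⟨f, hf⟩ := exists_map_univ_eq (s := t.branches) rfl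
    have hmem : ∀ i, f i ∈ ih.toFinset := fun i => by
      have hi : f i ∈ t.branches := by
        rw [← hf]; exact Multiset.mem_map_of_mem _ (Finset.mem_univ_val _)
      have := order_lt_of_mem_branches hi
      rw [Set.Finite.mem_toFinset]
      exact (show (f i).order ≤ n by omega)
    simp only [Set.mem_iUnion]
    refine ⟨t.branches.card, Finset.mem_range.2 (by omega), fun i => ⟨f i, hmem i⟩, ?_⟩
    simp only [hf, node_branches]

/-- The finite set of trees with at most `n` vertices. -/
def upTo (n : ℕ) : Finset RTree := (finite_order_le n).toFinset

theorem mem_upTo {n : ℕ} {t : RTree} : t ∈ upTo n ↔ t.order ≤ n := by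
  simp [upTo]

theorem upTo_zero : upTo 0 = ∅ := Finset.eq_empty_of_forall_notMem fun t ht =>
  t.order_pos.ne' (Nat.le_zero.1 (mem_upTo.1 ht))

open Classical in
theorem symmetry_eq (s : Multiset RTree) : ((node s).symmetry : ℝ) =
    (∏ t ∈ s.toFinset, ((s.count t)! : ℝ)) * (s.map fun t => (t.symmetry : ℝ)).prod := by
  rw [symmetry_node, Finset.prod_multiset_map_count]
  push_cast
  rw [Finset.prod_mul_distrib]

end RTree

section Analysis

variable {E F : Type*} [NormedAddCommGroup E] [NormedSpace ℝ E]
  [NormedAddCommGroup F] [NormedSpace ℝ F]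

/-! ### Iterated directional derivatives -/

/-- The iterated derivative of `W` in the constant directions of a list. -/
def dirDeriv (W : E → F) : List E → E → F
  | [] => W
  | v :: l => fun y => fderiv ℝ (dirDeriv W l) y v

theorem contDiff_dirDeriv {W : E → F} (hW : ContDiff ℝ ∞ W) (l : List E) :
    ContDiff ℝ ∞ (dirDeriv W l) := by
  induction l with
  | nil => exact hW
  | cons v l ih => exact (ih.fderiv_right (m := ∞) le_rfl).clm_apply contDiff_const

/-- A transposition of neighbours is symmetry of the second derivative. This is what makes
derivatives along a multiset meaningful. -/
theorem dirDeriv_perm {W : E → F} (hW : ContDiff ℝ ∞ W) {l l' : List E} (h : l.Perm l') :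
    dirDeriv W l = dirDeriv W l' := by
  induction h with
  | nil => rfl
  | cons v _ ih => simp only [dirDeriv, ih]
  | trans _ _ ih ih' => exact ih.trans ih'
  | swap v w l =>
    funext y
    have hl := contDiff_dirDeriv hW l
    have hsymm : IsSymmSndFDerivAt ℝ (dirDeriv W l) y :=
      hl.contDiffAt.isSymmSndFDerivAt (by
        rw [minSmoothness_of_isRCLikeNormedField]
        exact WithTop.coe_le_coe.2 (le_top : (2 : ℕ∞) ≤ ⊤))
    have hd : DifferentiableAt ℝ (fderiv ℝ (dirDeriv W l)) y :=
      ((hl.fderiv_right (m := ∞) le_rfl).differentiable (by simp)) y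
    have key : ∀ a b : E, dirDeriv W (a :: b :: l) y =
        fderiv ℝ (fderiv ℝ (dirDeriv W l)) y a b := fun a b => by
      simp only [dirDeriv]
      rw [fderiv_clm_apply hd (differentiableAt_const b)]
      simp
    rw [key, key, hsymm.eq]

theorem dirDeriv_ofFn {W : E → F} (hW : ContDiff ℝ ∞ W) {k : ℕ} (v : Fin k → E) (y : E) :
    dirDeriv W (List.ofFn v) y = iteratedFDeriv ℝ k W y v := by
  induction k generalizing y with
  | zero => simp [dirDeriv]
  | succ k ih =>
    have hd : DifferentiableAt ℝ (iteratedFDeriv ℝ k W) y :=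
      (hW.differentiable_iteratedFDeriv (by exact_mod_cast WithTop.coe_lt_top k)) y
    rw [List.ofFn_succ, dirDeriv, funext (ih fun i => v i.succ), hd.iteratedFDeriv_succ_apply_left']
    rfl

/-- The iterated derivative of `W` in the directions of a multiset. -/
def multiDeriv (W : E → F) (y : E) (s : Multiset E) : F := dirDeriv W s.toList y

theorem multiDeriv_coe {W : E → F} (hW : ContDiff ℝ ∞ W) (y : E) (l : List E) :
    multiDeriv W y l = dirDeriv W l y := by
  rw [multiDeriv, dirDeriv_perm hW (Multiset.coe_eq_coe.1 (Multiset.coe_toList _))]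

theorem multiDeriv_map_univ {W : E → F} (hW : ContDiff ℝ ∞ W) (y : E) {k : ℕ} (v : Fin k → E) :
    multiDeriv W y (Finset.univ.val.map v) = iteratedFDeriv ℝ k W y v := by
  rw [Fin.univ_val_map, multiDeriv_coe hW, dirDeriv_ofFn hW]

theorem multiDeriv_zero (W : E → F) (y : E) : multiDeriv W y 0 = W y := by
  simp [multiDeriv, dirDeriv]

theorem multiDeriv_cons {W : E → F} (hW : ContDiff ℝ ∞ W) (y : E) (v : E) (s : Multiset E) :
    multiDeriv W y (v ::ₘ s) = fderiv ℝ (fun z => multiDeriv W z s) y v := by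
  rw [← Multiset.coe_toList s, Multiset.cons_coe]
  simp only [multiDeriv_coe hW]
  rfl

theorem multiDeriv_sum_cons {W : E → F} (hW : ContDiff ℝ ∞ W) (y : E) {ι : Type*} (S : Finset ι)
    (v : ι → E) (s : Multiset E) :
    multiDeriv W y ((∑ i ∈ S, v i) ::ₘ s) = ∑ i ∈ S, multiDeriv W y (v i ::ₘ s) := by
  simp only [multiDeriv_cons hW, map_sum]

theorem norm_multiDeriv_le {W : E → F} (hW : ContDiff ℝ ∞ W) {M : ℝ} {y : E} (s : Multiset E)
    (hM : ‖iteratedFDeriv ℝ s.card W y‖ ≤ M) :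
    ‖multiDeriv W y s‖ ≤ M * (s.map norm).prod := by
  obtain ⟨v, hv⟩ := exists_map_univ_eq (s := s) rfl
  have h1 : ‖multiDeriv W y s‖ = ‖iteratedFDeriv ℝ s.card W y v‖ := by
    rw [← multiDeriv_map_univ hW, hv]
  have h2 : (s.map norm).prod = ∏ i, ‖v i‖ := by
    conv_lhs => rw [← hv, Multiset.map_map]
    rfl
  rw [h1, h2]
  exact (ContinuousMultilinearMap.le_opNorm _ _).trans (by gcongr)

theorem map_univ_update {α : Type*} {k : ℕ} (v : Fin k → α) (i : Fin k) (a : α) :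
    (Finset.univ.val.map (Function.update v i a)) =
      a ::ₘ (Finset.univ.erase i).val.map v := by
  conv_lhs => rw [← Finset.insert_erase (Finset.mem_univ i),
    Finset.insert_val_of_notMem (Finset.notMem_erase i _), Multiset.map_cons]
  rw [Function.update_self]
  congr 1
  refine Multiset.map_congr rfl fun j hj => ?_
  exact Function.update_of_ne (Finset.ne_of_mem_erase (Finset.mem_val ▸ hj)) _ _

/-- Product rule for a derivative of `W` along moving directions: moving the base point adds `z'` as
a further direction, and moving a direction replaces it by its velocity. The directions are indexed
by `S` so that coinciding ones stay distinguishable. -/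
theorem hasDerivWithinAt_multiDeriv {W : E → F} (hW : ContDiff ℝ ∞ W) {z : ℝ → E} {z' : E}
    {D : Set ℝ} {t : ℝ} (hz : HasDerivWithinAt z z' D t) {ι : Type*} [DecidableEq ι]
    (S : Finset ι) {v : ι → ℝ → E} {v' : ι → E}
    (hv : ∀ i ∈ S, HasDerivWithinAt (v i) (v' i) D t) :
    HasDerivWithinAt (fun s => multiDeriv W (z s) (S.val.map fun i => v i s))
      (multiDeriv W (z t) (z' ::ₘ S.val.map fun i => v i t) +
        ∑ i ∈ S, multiDeriv W (z t) (v' i ::ₘ (S.erase i).val.map fun j => v j t)) D t := by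
  -- Enumerating `S` by `Fin S.card` turns the expression into a continuous multilinear map applied
  -- to a tuple, for which the derivative is known.
  set e : Fin S.card ↪ ι := S.equivFin.symm.toEmbedding.trans (Function.Embedding.subtype _) with he
  have heS : Finset.univ.map e = S := by
    ext i
    simp only [Finset.mem_map, Finset.mem_univ, true_and, he]
    constructor
    · rintro ⟨a, rfl⟩
      exact (S.equivFin.symm a).2
    · intro hi
      exact ⟨S.equivFin ⟨i, hi⟩, by simp⟩
  have hmem : ∀ a, e a ∈ S := fun a => (S.equivFin.symm a).2
  have hval : ∀ g : ι → E, S.val.map g = Finset.univ.val.map fun a => g (e a) := fun g => by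
    conv_lhs => rw [← heS, Finset.map_val, Multiset.map_map]
    rfl
  have herase : ∀ (a : Fin S.card) (g : ι → E), (S.erase (e a)).val.map g =
      (Finset.univ.erase a).val.map fun b => g (e b) := fun a g => by
    have : S.erase (e a) = (Finset.univ.erase a).map e := by
      rw [Finset.map_erase, heS]
    rw [this, Finset.map_val, Multiset.map_map]
    rfl
  have hd : DifferentiableAt ℝ (iteratedFDeriv ℝ S.card W) (z t) :=
    (hW.differentiable_iteratedFDeriv (by exact_mod_cast WithTop.coe_lt_top S.card)) _
  have h1 : HasFDerivWithinAt (fun s => iteratedFDeriv ℝ S.card W (z s)) _ D t :=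
    (hd.hasFDerivAt.comp_hasDerivWithinAt t hz).hasFDerivWithinAt
  have h2 := (h1.continuousMultilinearMap_apply
    (fun a => (hv (e a) (hmem a)).hasFDerivWithinAt)).hasDerivWithinAt
  simp only [hval, multiDeriv_map_univ hW]
  refine h2.congr_deriv ?_
  have hsum : ∀ g : ι → F, ∑ i ∈ S, g i = ∑ a, g (e a) := fun g => by
    conv_lhs => rw [← heS, Finset.sum_map]
  rw [hsum]
  simp only [herase, ← map_univ_update, multiDeriv_map_univ hW]
  rw [multiDeriv_cons hW]
  simp only [multiDeriv_map_univ hW]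
  rw [fderiv_continuousMultilinear_apply_const_apply hd]
  simp [ContinuousMultilinearMap.toContinuousLinearMap]

end Analysis

/-! ### Elementary differentials -/

section Elementary

variable {E : Type} [NormedAddCommGroup E] [NormedSpace ℝ E]

/-- The elementary differential of `W` at `y`:
`F([t₁ ⋯ tₗ]) = W⁽ˡ⁾(F(t₁), …, F(tₗ))`. -/
def elemDiff (W : E → E) (y : E) (t : RTree) : E := t.fold (multiDeriv W y)

theorem elemDiff_node (W : E → E) (y : E) (s : Multiset RTree) :
    elemDiff W y (RTree.node s) = multiDeriv W y (s.map (elemDiff W y)) :=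
  RTree.fold_node _ _

theorem pow_sum_order (M : ℝ) (s : Multiset RTree) :
    M ^ (s.map RTree.order).sum = (s.map fun t => M ^ t.order).prod := by
  induction s using Multiset.induction with
  | empty => simp
  | cons t s ih => simp [pow_add, ih]

/-- Only the derivative at the root is bounded here, so the estimate also serves trees of large
order that are grafted from few small branches. -/
theorem norm_elemDiff_node_le {W : E → E} (hW : ContDiff ℝ ∞ W) {M : ℝ} {y : E}
    {s : Multiset RTree} (hM : ‖iteratedFDeriv ℝ s.card W y‖ ≤ M)
    (hs : ∀ t ∈ s, ‖elemDiff W y t‖ ≤ M ^ t.order) :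
    ‖elemDiff W y (RTree.node s)‖ ≤ M ^ (RTree.node s).order := by
  have hM0 : 0 ≤ M := (norm_nonneg _).trans hM
  rw [elemDiff_node, RTree.order_node, pow_add, pow_one, pow_sum_order]
  refine (norm_multiDeriv_le hW (M := M) _ (by rwa [Multiset.card_map])).trans ?_
  gcongr
  rw [Multiset.map_map]
  exact Multiset.prod_map_le_prod_map₀ _ _ (fun _ _ => norm_nonneg _) hs

/-- One factor `M` per vertex; a vertex of a tree with at most `p + 1` vertices has at most `p`
children, so derivatives beyond order `p` never occur. -/
theorem norm_elemDiff_le {W : E → E} (hW : ContDiff ℝ ∞ W) {M : ℝ} {p : ℕ} {y : E}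
    (hM : ∀ k ≤ p, ‖iteratedFDeriv ℝ k W y‖ ≤ M) (t : RTree) (ht : t.order ≤ p + 1) :
    ‖elemDiff W y t‖ ≤ M ^ t.order := by
  revert ht
  refine RTree.induction (p := fun t => t.order ≤ p + 1 → ‖elemDiff W y t‖ ≤ M ^ t.order)
    (fun s ih ht => ?_) t
  have hcard := (RTree.node s).card_branches_lt_order
  rw [RTree.branches_node] at hcard
  refine norm_elemDiff_node_le hW (hM _ (by omega)) fun t h => ih t h ?_
  have := RTree.order_lt_of_mem_branches (t := RTree.node s) (t' := t)
    (by rwa [RTree.branches_node])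
  omega

end Elementary

namespace LTree

/-! ### Structure of labelled trees -/

theorem eq_of_V_E {u u' : LTree} (hV : u.V = u'.V) (hE : u.E = u'.E) : u = u' := by
  cases u; cases u'; cases hV; cases hE; rfl

/-- `x` is the parent of `y`. -/
def Edge (u : LTree) (x y : ℤ) : Prop := (x, y) ∈ u.E

/-- There is a directed path, possibly of length `0`, from `x` to `y`. -/
abbrev Reaches (u : LTree) (x y : ℤ) : Prop := Relation.ReflTransGen u.Edge x y

theorem Edge.lt {u : LTree} {x y : ℤ} (h : u.Edge x y) : x < y := (u.edge_mem _ h).2.2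

theorem Edge.right_mem {u : LTree} {x y : ℤ} (h : u.Edge x y) : y ∈ u.V := (u.edge_mem _ h).2.1

theorem Edge.left_mem {u : LTree} {x y : ℤ} (h : u.Edge x y) : x ∈ u.V := (u.edge_mem _ h).1

theorem mem_children {u : LTree} {x y : ℤ} : y ∈ u.children x ↔ u.Edge x y := by
  rw [children, Finset.mem_filter]
  exact ⟨fun h => h.2, fun h => ⟨Edge.right_mem h, h⟩⟩

theorem shapeAt_eq (u : LTree) (x : ℤ) :
    u.shapeAt x = RTree.node ((u.children x).val.map u.shapeAt) := by
  rw [shapeAt]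
  congr 1
  exact Multiset.attach_map_val' (u.children x).val u.shapeAt

theorem children_induction (u : LTree) {p : ℤ → Prop}
    (h : ∀ x, (∀ y ∈ u.children x, p y) → p x) (x : ℤ) : p x :=
  shapeAt.induct u p (fun x ih => h x fun y hy => ih ⟨y, hy⟩) x

theorem Reaches.le {u : LTree} {x y : ℤ} (h : u.Reaches x y) : x ≤ y := by
  induction h with
  | refl => exact le_rfl
  | tail _ h ih => exact ih.trans h.lt.le

theorem Reaches.mem {u : LTree} {x y : ℤ} (h : u.Reaches x y) (hx : x ∈ u.V) : y ∈ u.V := by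
  induction h with
  | refl => exact hx
  | tail _ h _ => exact h.right_mem

/-- The sets of vertices reached from two siblings are disjoint. -/
theorem eq_of_edge_of_reaches {u : LTree} {x c c' v : ℤ} (hc : u.Edge x c) (hc' : u.Edge x c')
    (h : u.Reaches c v) (h' : u.Reaches c' v) : c = c' := by
  have key : ∀ {c c' : ℤ}, u.Edge x c → u.Edge x c' → u.Reaches c c' → c = c' := by
    intro c c' hc hc' hr
    rcases Relation.ReflTransGen.cases_tail hr with rfl | ⟨d, hd, hdc⟩
    · rfl
    · have hdx : d = x := u.parent_unique d x c' hdc hc'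
      subst hdx
      exact absurd (Reaches.le hd) (not_le.2 hc.lt)
  -- Parents are unique, so the ancestors of `v` form a chain and `c`, `c'` are comparable; siblings
  -- are comparable only if equal.
  have hru : Relator.RightUnique (Function.swap u.Edge) := fun a b d hb hd =>
    u.parent_unique b d a hb hd
  rcases Relation.ReflTransGen.total_of_right_unique hru h.swap h'.swap with h1 | h1
  · exact (key hc' hc h1.swap).symm
  · exact key hc hc' h1.swap

open Classical in
/-- The vertices that can be reached from `x`. -/
def desc (u : LTree) (x : ℤ) : Finset ℤ := u.V.filter fun v => u.Reaches x v

open Classical in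
theorem mem_desc {u : LTree} {x v : ℤ} (hx : x ∈ u.V) : v ∈ u.desc x ↔ u.Reaches x v := by
  rw [desc, Finset.mem_filter]
  exact ⟨fun h => h.2, fun h => ⟨Reaches.mem h hx, h⟩⟩

open Classical in
-- The descendants of `x` are `x` itself and the pairwise disjoint sets of descendants of its
-- children.
theorem sum_desc {M : Type*} [AddCommMonoid M] (u : LTree) {x : ℤ} (hx : x ∈ u.V) (f : ℤ → M) :
    ∑ v ∈ u.desc x, f v = f x + ∑ c ∈ u.children x, ∑ v ∈ u.desc c, f v := by
  have hmem : ∀ {c v}, c ∈ u.children x → (v ∈ u.desc c ↔ u.Reaches c v) := fun hc =>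
    mem_desc (mem_children.1 hc).right_mem
  have hdesc : u.desc x = insert x ((u.children x).biUnion u.desc) := by
    ext v
    rw [mem_desc hx, Finset.mem_insert, Finset.mem_biUnion]
    constructor
    · intro h
      rcases Relation.ReflTransGen.cases_head h with rfl | ⟨c, hc, hcv⟩
      · exact Or.inl rfl
      · exact Or.inr ⟨c, mem_children.2 hc, (hmem (mem_children.2 hc)).2 hcv⟩
    · rintro (rfl | ⟨c, hc, hcv⟩)
      · exact Relation.ReflTransGen.refl
      · exact Relation.ReflTransGen.head (mem_children.1 hc) ((hmem hc).1 hcv)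
  have hnot : x ∉ (u.children x).biUnion u.desc := fun h => by
    obtain ⟨c, hc, hcx⟩ := Finset.mem_biUnion.1 h
    exact absurd ((hmem hc).1 hcx).le (not_le.2 (mem_children.1 hc).lt)
  rw [hdesc, Finset.sum_insert hnot, Finset.sum_biUnion]
  intro c hc c' hc' hne
  refine Finset.disjoint_left.2 fun v hv hv' => hne ?_
  exact eq_of_edge_of_reaches (mem_children.1 hc) (mem_children.1 hc') ((hmem hc).1 hv)
    ((hmem hc').1 hv')

theorem order_shapeAt (u : LTree) (x : ℤ) : x ∈ u.V → (u.shapeAt x).order = (u.desc x).card := by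
  refine u.children_induction (p := fun x => x ∈ u.V → (u.shapeAt x).order = (u.desc x).card)
    (fun x ih hx => ?_) x
  rw [shapeAt_eq, RTree.order_node, Multiset.map_map, Finset.card_eq_sum_ones, sum_desc u hx]
  congr 1
  refine Finset.sum_congr rfl fun c hc => ?_
  rw [← Finset.card_eq_sum_ones]
  exact ih c hc (mem_children.1 hc).right_mem

theorem root_mem (u : LTree) : u.root ∈ u.V := Finset.min'_mem _ _

theorem root_le (u : LTree) {x : ℤ} (hx : x ∈ u.V) : u.root ≤ x := Finset.min'_le _ _ hx

/-- Edges increase, so no nontrivial path ends at the least vertex; connectedness then leaves only a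
path from the root to `y`, whose last edge supplies the parent. -/
theorem exists_parent (u : LTree) {y : ℤ} (hy : y ∈ u.V) (hne : y ≠ u.root) :
    ∃ x, u.Edge x y := by
  have hlt : ∀ {a b : ℤ}, Relation.TransGen u.Edge a b → a < b := fun h =>
    Relation.TransGen.trans_induction_on h (fun h => h.lt) fun _ _ => lt_trans
  rcases u.connected u.root u.root_mem y hy hne.symm with h | h | ⟨z, hz, -, -, h, -⟩
  · obtain ⟨x, -, hx⟩ := Relation.TransGen.tail'_iff.1 h
    exact ⟨x, hx⟩
  · exact absurd (hlt h) (not_lt.2 (u.root_le hy))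
  · exact absurd (hlt h) (not_lt.2 (u.root_le hz))

theorem root_reaches (u : LTree) {y : ℤ} (hy : y ∈ u.V) : u.Reaches u.root y := by
  induction y using Int.strongRec (m := u.root) with
  | lt n hn => exact absurd (u.root_le hy) (not_le.2 hn)
  | ge n hn ih =>
    by_cases hne : n = u.root
    · rw [hne]
    · obtain ⟨x, hx⟩ := u.exists_parent hy hne
      exact (ih x hx.lt hx.left_mem).tail hx

theorem desc_root (u : LTree) : u.desc u.root = u.V := by
  ext v
  exact ⟨fun h => ((mem_desc u.root_mem).1 h).mem u.root_mem,
    fun h => (mem_desc u.root_mem).2 (u.root_reaches h)⟩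

theorem order_shape (u : LTree) : u.shape.order = u.V.card := by
  rw [shape, order_shapeAt u _ u.root_mem, desc_root]

/-- A set of increasing edges in which every vertex but the least one has exactly one parent
forms a labelled tree. -/
def ofParents (V : Finset ℤ) (E : Finset (ℤ × ℤ)) (hV : V.Nonempty)
    (hE : ∀ e ∈ E, e.1 ∈ V ∧ e.2 ∈ V ∧ e.1 < e.2)
    (huniq : ∀ x x' y : ℤ, (x, y) ∈ E → (x', y) ∈ E → x = x')
    (hpar : ∀ y ∈ V, y ≠ V.min' hV → ∃ x, (x, y) ∈ E) : LTree where
  V := V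
  E := E
  nonempty := hV
  edge_mem := hE
  parent_unique := huniq
  connected := by
    have hroot : ∀ y, y ∈ V → y ≠ V.min' hV →
        Relation.TransGen (fun a b => (a, b) ∈ E) (V.min' hV) y := by
      intro y
      induction y using Int.strongRec (m := V.min' hV) with
      | lt n hn => exact fun hy => absurd (V.min'_le _ hy) (not_le.2 hn)
      | ge n hn ih =>
        intro hy hne
        obtain ⟨x, hx⟩ := hpar n hy hne
        obtain ⟨hxV, -, hlt⟩ := hE _ hx
        by_cases h : x = V.min' hV
        · rw [← h]
          exact Relation.TransGen.single hx
        · exact (ih x hlt hxV h).tail hx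
    intro x hx y hy hxy
    by_cases h : x = V.min' hV
    · subst h
      exact Or.inl (hroot y hy hxy.symm)
    · by_cases h' : y = V.min' hV
      · subst h'
        exact Or.inr (Or.inl (hroot x hx h))
      · exact Or.inr (Or.inr ⟨_, V.min'_mem hV, Ne.symm h, Ne.symm h', hroot x hx h, hroot y hy h'⟩)

/-! ### Adding a leaf with the largest label -/

theorem min'_insert_of_lt {V : Finset ℤ} (hV : V.Nonempty) {w : ℤ} (hw : ∀ z ∈ V, z < w) :
    (insert w V).min' (Finset.insert_nonempty w V) = V.min' hV := by
  rw [Finset.min'_insert w V hV]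
  exact min_eq_right (hw _ (V.min'_mem hV)).le

/-- The tree with a new leaf `w`, larger than all vertices, attached to the vertex `v`. -/
def attachLeaf (u : LTree) (v w : ℤ) (hv : v ∈ u.V) (hw : ∀ z ∈ u.V, z < w) : LTree :=
  ofParents (insert w u.V) (insert (v, w) u.E) (Finset.insert_nonempty _ _)
    (by
      intro e he
      rcases Finset.mem_insert.1 he with rfl | he
      · exact ⟨Finset.mem_insert_of_mem hv, Finset.mem_insert_self _ _, hw v hv⟩
      · obtain ⟨h1, h2, h3⟩ := u.edge_mem e he
        exact ⟨Finset.mem_insert_of_mem h1, Finset.mem_insert_of_mem h2, h3⟩)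
    (by
      have hno : ∀ x, (x, w) ∉ u.E := fun x hx => lt_irrefl _ (hw w (u.edge_mem _ hx).2.1)
      intro x x' y h h'
      rcases Finset.mem_insert.1 h with h | h <;> rcases Finset.mem_insert.1 h' with h' | h'
      · rw [Prod.mk.injEq] at h h'
        rw [h.1, h'.1]
      · rw [Prod.mk.injEq] at h
        exact absurd (h.2 ▸ h') (hno _)
      · rw [Prod.mk.injEq] at h'
        exact absurd (h'.2 ▸ h) (hno _)
      · exact u.parent_unique x x' y h h')
    (by
      intro y hy hne
      rw [min'_insert_of_lt u.nonempty hw] at hne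
      rcases Finset.mem_insert.1 hy with rfl | hy
      · exact ⟨v, Finset.mem_insert_self _ _⟩
      · obtain ⟨x, hx⟩ := u.exists_parent hy hne
        exact ⟨x, Finset.mem_insert_of_mem hx⟩)

open Classical in
/-- `attachLeaf`, extended by `u` to all labels. -/
def addLeaf (u : LTree) (v w : ℤ) : LTree :=
  if h : v ∈ u.V ∧ ∀ z ∈ u.V, z < w then u.attachLeaf v w h.1 h.2 else u

section AddLeaf

variable {u : LTree} {v w : ℤ} (hv : v ∈ u.V) (hw : ∀ z ∈ u.V, z < w)
include hv hw

theorem addLeaf_V : (u.addLeaf v w).V = insert w u.V := by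
  rw [addLeaf, dif_pos ⟨hv, hw⟩]; rfl

theorem addLeaf_E : (u.addLeaf v w).E = insert (v, w) u.E := by
  rw [addLeaf, dif_pos ⟨hv, hw⟩]; rfl

theorem addLeaf_edge {x y : ℤ} : (u.addLeaf v w).Edge x y ↔ (x = v ∧ y = w) ∨ u.Edge x y := by
  rw [Edge, addLeaf_E hv hw, Finset.mem_insert, Prod.mk.injEq]
  rfl

theorem addLeaf_root : (u.addLeaf v w).root = u.root := by
  have hV := addLeaf_V hv hw
  simp only [root, hV]
  exact min'_insert_of_lt u.nonempty hw

theorem children_addLeaf_self : (u.addLeaf v w).children v = insert w (u.children v) := by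
  ext y
  simp [mem_children, addLeaf_edge hv hw]

theorem children_addLeaf_of_ne {x : ℤ} (hx : x ≠ v) :
    (u.addLeaf v w).children x = u.children x := by
  ext y
  simp [mem_children, addLeaf_edge hv hw, hx]

theorem shapeAt_addLeaf_of_not_reaches (x : ℤ) :
    ¬ u.Reaches x v → (u.addLeaf v w).shapeAt x = u.shapeAt x := by
  refine u.children_induction
    (p := fun x => ¬ u.Reaches x v → (u.addLeaf v w).shapeAt x = u.shapeAt x) (fun x ih hx => ?_) x
  have hne : x ≠ v := fun h => hx (h ▸ Relation.ReflTransGen.refl)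
  rw [shapeAt_eq, shapeAt_eq, children_addLeaf_of_ne hv hw hne]
  congr 1
  refine Multiset.map_congr rfl fun c hc => ih c hc fun h => hx ?_
  exact Relation.ReflTransGen.head (mem_children.1 hc) h

theorem shapeAt_addLeaf_leaf : (u.addLeaf v w).shapeAt w = RTree.node 0 := by
  rw [shapeAt_addLeaf_of_not_reaches hv hw w fun h => absurd h.le (not_le.2 (hw v hv)), shapeAt_eq]
  have : u.children w = ∅ := Finset.eq_empty_of_forall_notMem fun y hy =>
    lt_irrefl _ (hw w (mem_children.1 hy).left_mem)
  rw [this]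
  rfl

theorem shapeAt_addLeaf_self :
    (u.addLeaf v w).shapeAt v = RTree.node (RTree.node 0 ::ₘ (u.children v).val.map u.shapeAt) := by
  have hnot : w ∉ u.children v := fun h => lt_irrefl _ (hw w (mem_children.1 h).right_mem)
  rw [shapeAt_eq, children_addLeaf_self hv hw, Finset.insert_val_of_notMem hnot, Multiset.map_cons,
    shapeAt_addLeaf_leaf hv hw]
  congr 2
  refine Multiset.map_congr rfl fun c hc => shapeAt_addLeaf_of_not_reaches hv hw c fun h => ?_
  exact absurd h.le (not_le.2 (mem_children.1 hc).lt)

/-- The new leaf lies below exactly one child of `x`, so the other branches are unchanged. -/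
theorem shapeAt_addLeaf_of_child {x c : ℤ} (hc : c ∈ u.children x) (hcv : u.Reaches c v) :
    (u.addLeaf v w).shapeAt x = RTree.node ((u.addLeaf v w).shapeAt c ::ₘ
      ((u.children x).erase c).val.map u.shapeAt) := by
  have hne : x ≠ v := fun h => by
    subst h
    exact absurd hcv.le (not_le.2 (mem_children.1 hc).lt)
  rw [shapeAt_eq, children_addLeaf_of_ne hv hw hne]
  conv_lhs => rw [← Finset.insert_erase hc,
    Finset.insert_val_of_notMem (Finset.notMem_erase c _), Multiset.map_cons]
  congr 2
  refine Multiset.map_congr rfl fun d hd => shapeAt_addLeaf_of_not_reaches hv hw d fun h => ?_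
  obtain ⟨hdc, hd⟩ := Finset.mem_erase.1 (Finset.mem_val ▸ hd)
  exact hdc (eq_of_edge_of_reaches (mem_children.1 hd) (mem_children.1 hc) h hcv)

end AddLeaf

/-! ### Differentiating elementary differentials along solutions -/

section Deriv

variable {E : Type} [NormedAddCommGroup E] [NormedSpace ℝ E]

/-- Along a solution of `z' = W(z)`, the derivative of the elementary differential of a tree is the
sum over all ways to attach a leaf. -/
theorem hasDerivWithinAt_elemDiff_shapeAt {W : E → E} (hW : ContDiff ℝ ∞ W) {z : ℝ → E} {D : Set ℝ}
    {t : ℝ} (hz : HasDerivWithinAt z (W (z t)) D t) {u : LTree} {w : ℤ} (hw : ∀ y ∈ u.V, y < w)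
    (x : ℤ) : x ∈ u.V → HasDerivWithinAt (fun s => elemDiff W (z s) (u.shapeAt x))
      (∑ v ∈ u.desc x, elemDiff W (z t) ((u.addLeaf v w).shapeAt x)) D t := by
  refine u.children_induction (p := fun x => x ∈ u.V →
    HasDerivWithinAt (fun s => elemDiff W (z s) (u.shapeAt x))
      (∑ v ∈ u.desc x, elemDiff W (z t) ((u.addLeaf v w).shapeAt x)) D t) (fun x ih hx => ?_) x
  have hexp : ∀ y, elemDiff W y (u.shapeAt x) =
      multiDeriv W y ((u.children x).val.map fun c => elemDiff W y (u.shapeAt c)) := fun y => by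
    rw [shapeAt_eq, elemDiff_node, Multiset.map_map]
    rfl
  simp only [hexp]
  refine (hasDerivWithinAt_multiDeriv hW hz (u.children x)
    (fun c hc => ih c hc (mem_children.1 hc).right_mem)).congr_deriv ?_
  -- The term `v = x` comes from the moving base point: the velocity `W (z t)` is the elementary
  -- differential of the new one-vertex branch. The terms with `v` below a child `c` come from
  -- differentiating the direction of `c`.
  rw [sum_desc u hx, shapeAt_addLeaf_self hx hw, elemDiff_node, Multiset.map_cons, elemDiff_node,
    Multiset.map_zero, multiDeriv_zero, Multiset.map_map]
  congr 1
  refine Finset.sum_congr rfl fun c hc => ?_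
  rw [multiDeriv_sum_cons hW]
  refine Finset.sum_congr rfl fun v hv => ?_
  have hcV := (mem_children.1 hc).right_mem
  have hcv := (mem_desc hcV).1 hv
  rw [shapeAt_addLeaf_of_child (hcv.mem hcV) hw hc hcv, elemDiff_node, Multiset.map_cons,
    Multiset.map_map]
  rfl

theorem hasDerivWithinAt_elemDiff_shape {W : E → E} (hW : ContDiff ℝ ∞ W) {z : ℝ → E} {D : Set ℝ}
    {t : ℝ} (hz : HasDerivWithinAt z (W (z t)) D t) {u : LTree} {w : ℤ} (hw : ∀ y ∈ u.V, y < w) :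
    HasDerivWithinAt (fun s => elemDiff W (z s) u.shape)
      (∑ v ∈ u.V, elemDiff W (z t) (u.addLeaf v w).shape) D t := by
  refine (hasDerivWithinAt_elemDiff_shapeAt hW hz hw u.root u.root_mem).congr_deriv ?_
  rw [desc_root]
  refine Finset.sum_congr rfl fun v hv => ?_
  rw [shape, addLeaf_root hv hw]

end Deriv

/-! ### Labelled trees with vertex set `{1, …, n}` -/

theorem finite_labelled (n : ℕ) : {u : LTree | u.V = Finset.Icc 1 (n : ℤ)}.Finite := by
  refine Set.Finite.of_finite_image (f := LTree.E) ?_ fun u hu u' hu' h =>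
    eq_of_V_E (Eq.trans hu (Eq.symm hu')) h
  refine (Finset.finite_toSet (Finset.Icc (1 : ℤ) n ×ˢ Finset.Icc (1 : ℤ) n).powerset).subset ?_
  rintro _ ⟨u, hu, rfl⟩
  have hu' : u.V = Finset.Icc 1 (n : ℤ) := hu
  rw [Finset.mem_coe, Finset.mem_powerset]
  intro e he
  obtain ⟨h1, h2, -⟩ := u.edge_mem e he
  exact Finset.mem_product.2 ⟨hu' ▸ h1, hu' ▸ h2⟩

/-- The labelled trees with vertex set `{1, …, n}`. -/
def labelled (n : ℕ) : Finset LTree := (finite_labelled n).toFinset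

theorem mem_labelled {n : ℕ} {u : LTree} : u ∈ labelled n ↔ u.V = Finset.Icc 1 (n : ℤ) := by
  simp [labelled]

theorem lt_of_mem_labelled {n : ℕ} {u : LTree} (hu : u ∈ labelled n) :
    ∀ y ∈ u.V, y < (n : ℤ) + 1 := fun y hy => by
  rw [mem_labelled.1 hu, Finset.mem_Icc] at hy
  omega

theorem order_shape_of_mem_labelled {n : ℕ} {u : LTree} (hu : u ∈ labelled n) :
    u.shape.order = n := by
  rw [order_shape, mem_labelled.1 hu]
  simp

theorem insert_Icc (n : ℕ) : insert ((n : ℤ) + 1) (Finset.Icc 1 (n : ℤ)) =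
    Finset.Icc 1 ((n + 1 : ℕ) : ℤ) := by
  ext y
  simp only [Finset.mem_insert, Finset.mem_Icc]
  push_cast
  omega

theorem addLeaf_mem_labelled {n : ℕ} {u : LTree} (hu : u ∈ labelled n) {v : ℤ} (hv : v ∈ u.V) :
    u.addLeaf v ((n : ℤ) + 1) ∈ labelled (n + 1) := by
  rw [mem_labelled, addLeaf_V hv (lt_of_mem_labelled hu), mem_labelled.1 hu, insert_Icc]

/-- Every labelled tree with at least two vertices arises by adding its largest vertex. -/
theorem exists_addLeaf {n : ℕ} (hn : 1 ≤ n) {u : LTree} (hu : u ∈ labelled (n + 1)) :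
    ∃ u' ∈ labelled n, ∃ v ∈ u'.V, u'.addLeaf v ((n : ℤ) + 1) = u := by
  have hV := mem_labelled.1 hu
  rw [← insert_Icc] at hV
  have hne : (Finset.Icc 1 (n : ℤ)).Nonempty := ⟨1, Finset.mem_Icc.2 ⟨le_rfl, by exact_mod_cast hn⟩⟩
  have hlt : ∀ z ∈ Finset.Icc 1 (n : ℤ), z < (n : ℤ) + 1 := fun z hz => by
    rw [Finset.mem_Icc] at hz
    omega
  have hmem : ∀ {x}, x ∈ u.V ↔ x = (n : ℤ) + 1 ∨ x ∈ Finset.Icc 1 (n : ℤ) := by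
    intro x
    rw [hV, Finset.mem_insert]
  have hroot : u.root = (Finset.Icc 1 (n : ℤ)).min' hne := by
    simp only [root, hV]
    exact min'_insert_of_lt hne hlt
  have hle : ∀ x ∈ u.V, x ≤ (n : ℤ) + 1 := fun x hx => by
    rcases hmem.1 hx with h | h
    · exact h.le
    · exact (hlt x h).le
  have hrootmem := Finset.min'_mem _ hne
  rw [← hroot] at hrootmem
  -- The largest vertex has no outgoing edge, so dropping the edge into it removes it entirely.
  let u' : LTree := ofParents (Finset.Icc 1 (n : ℤ)) (u.E.filter fun e => e.2 ≠ (n : ℤ) + 1) hne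
    (by
      intro e he
      obtain ⟨he, hne⟩ := Finset.mem_filter.1 he
      obtain ⟨h1, h2, h3⟩ := u.edge_mem e he
      have := hle _ h2
      exact ⟨(hmem.1 h1).resolve_left (by omega), (hmem.1 h2).resolve_left hne, h3⟩)
    (fun x x' y h h' => u.parent_unique x x' y (Finset.mem_filter.1 h).1 (Finset.mem_filter.1 h').1)
    (by
      intro y hy hy'
      rw [← hroot] at hy'
      obtain ⟨x, hx⟩ := u.exists_parent (hmem.2 (Or.inr hy)) hy'
      exact ⟨x, Finset.mem_filter.2 ⟨hx, (hlt y hy).ne⟩⟩)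
  have hu' : u' ∈ labelled n := mem_labelled.2 rfl
  obtain ⟨v, hv⟩ := u.exists_parent (hmem.2 (Or.inl rfl)) (hlt _ hrootmem).ne'
  have hvu : v ∈ u'.V := (hmem.1 hv.left_mem).resolve_left hv.lt.ne
  refine ⟨u', hu', v, hvu, eq_of_V_E ?_ ?_⟩
  · rw [addLeaf_V hvu (lt_of_mem_labelled hu'), hV]
    rfl
  · rw [addLeaf_E hvu (lt_of_mem_labelled hu')]
    ext e
    obtain ⟨x, y⟩ := e
    rw [Finset.mem_insert, show u'.E = u.E.filter fun e => e.2 ≠ (n : ℤ) + 1 from rfl,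
      Finset.mem_filter, Prod.mk.injEq]
    constructor
    · rintro (⟨rfl, rfl⟩ | h)
      · exact hv
      · exact h.1
    · intro h
      by_cases hy : y = (n : ℤ) + 1
      · subst hy
        exact Or.inl ⟨u.parent_unique _ _ _ h hv, rfl⟩
      · exact Or.inr ⟨h, hy⟩

/-- The parent of the largest vertex recovers `v`, and deleting that edge recovers `u`. -/
theorem addLeaf_injective {n : ℕ} {u u' : LTree} (hu : u ∈ labelled n) (hu' : u' ∈ labelled n)
    {v v' : ℤ} (hv : v ∈ u.V) (hv' : v' ∈ u'.V)
    (h : u.addLeaf v ((n : ℤ) + 1) = u'.addLeaf v' ((n : ℤ) + 1)) : u = u' ∧ v = v' := by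
  have hE := congrArg LTree.E h
  rw [addLeaf_E hv (lt_of_mem_labelled hu), addLeaf_E hv' (lt_of_mem_labelled hu')] at hE
  have hno : ∀ {u : LTree}, u ∈ labelled n → ∀ {x}, (x, (n : ℤ) + 1) ∉ u.E := fun hu x hx =>
    lt_irrefl _ (lt_of_mem_labelled hu _ (LTree.edge_mem _ _ hx).2.1)
  have hvv : v = v' := by
    have h1 : (v, (n : ℤ) + 1) ∈ insert (v', (n : ℤ) + 1) u'.E := hE ▸ Finset.mem_insert_self _ _
    rcases Finset.mem_insert.1 h1 with h1 | h1
    · exact (Prod.mk.injEq _ _ _ _ ▸ h1).1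
    · exact absurd h1 (hno hu')
  subst hvv
  refine ⟨eq_of_V_E ((mem_labelled.1 hu).trans (mem_labelled.1 hu').symm) ?_, rfl⟩
  rw [← Finset.erase_insert (hno hu (x := v)), hE, Finset.erase_insert (hno hu')]

theorem sum_labelled_succ {M : Type*} [AddCommMonoid M] {n : ℕ} (hn : 1 ≤ n) (f : LTree → M) :
    ∑ u ∈ labelled (n + 1), f u =
      ∑ u ∈ labelled n, ∑ v ∈ u.V, f (u.addLeaf v ((n : ℤ) + 1)) := by
  rw [Finset.sum_sigma']
  symm
  refine Finset.sum_bij (fun p _ => p.1.addLeaf p.2 ((n : ℤ) + 1)) ?_ ?_ ?_ fun _ _ => rfl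
  · rintro ⟨u, v⟩ h
    obtain ⟨hu, hv⟩ := Finset.mem_sigma.1 h
    exact addLeaf_mem_labelled hu hv
  · rintro ⟨u, v⟩ h ⟨u', v'⟩ h' heq
    obtain ⟨hu, hv⟩ := Finset.mem_sigma.1 h
    obtain ⟨hu', hv'⟩ := Finset.mem_sigma.1 h'
    obtain ⟨rfl, h2⟩ := addLeaf_injective hu hu' hv hv' heq
    exact congrArg (Sigma.mk u) h2
  · intro u hu
    obtain ⟨u', hu', v, hv, rfl⟩ := exists_addLeaf hn hu
    exact ⟨⟨u', v⟩, Finset.mem_sigma.2 ⟨hu', hv⟩, rfl⟩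

/-- The labelled tree whose only vertex is `1`. -/
def singleVertex : LTree :=
  ofParents {1} ∅ (Finset.singleton_nonempty 1) (by simp) (by simp) (by simp)

theorem labelled_one : labelled 1 = {singleVertex} := by
  ext u
  rw [mem_labelled, Finset.mem_singleton]
  constructor
  · intro h
    have hV : u.V = {1} := by simpa using h
    refine eq_of_V_E hV (Finset.eq_empty_of_forall_notMem fun e he => ?_)
    obtain ⟨h1, h2, h3⟩ := u.edge_mem e he
    rw [hV, Finset.mem_singleton] at h1 h2
    omega
  · rintro rfl
    simp [singleVertex, ofParents]

theorem shape_singleVertex : singleVertex.shape = RTree.node 0 := by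
  rw [shape, shapeAt_eq]
  rfl

end LTree

theorem RTree.labellings_eq (t : RTree) [DecidablePred fun u : LTree => u.shape = t] :
    t.labellings = ((LTree.labelled t.order).filter fun u => u.shape = t).card := by
  exact Nat.subtype_card _ fun u => by rw [Finset.mem_filter, LTree.mem_labelled]

open Classical in
theorem LTree.sum_labelled_shape {M : Type*} [AddCommMonoid M] {n m : ℕ} (hnm : n ≤ m)
    (f : RTree → M) : ∑ u ∈ LTree.labelled n, f u.shape =
      ∑ t ∈ (RTree.upTo m).filter (fun t => t.order = n), t.labellings • f t := by
  rw [← Finset.sum_fiberwise_of_maps_to (g := LTree.shape)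
    (t := (RTree.upTo m).filter fun t => t.order = n) (fun u hu => by
      have := LTree.order_shape_of_mem_labelled hu
      exact Finset.mem_filter.2 ⟨RTree.mem_upTo.2 (this.trans_le hnm), this⟩)]
  refine Finset.sum_congr rfl fun t ht => ?_
  obtain rfl := (Finset.mem_filter.1 ht).2
  rw [RTree.labellings_eq, ← Finset.sum_const]
  exact Finset.sum_congr rfl fun u hu => by rw [(Finset.mem_filter.1 hu).2]

/-! ### Taylor expansion of the exact solution -/

section Taylor

variable {E : Type*} [NormedAddCommGroup E] [NormedSpace ℝ E]

/-- The successive derivatives are supplied as a family, so that formulas in terms of trees can be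
used directly; the factor `1 / n !` in the remainder is discarded. -/
theorem norm_sub_taylor_le {f : ℕ → ℝ → E} {n : ℕ} {C : ℝ}
    (hf : ∀ k, ∀ t ∈ Set.Icc (0 : ℝ) 1, HasDerivWithinAt (f k) (f (k + 1) t) (Set.Icc 0 1) t)
    (hC : ∀ t ∈ Set.Icc (0 : ℝ) 1, ‖f (n + 1) t‖ ≤ C) :
    ‖f 0 1 - ∑ k ∈ Finset.range (n + 1), (k ! : ℝ)⁻¹ • f k 0‖ ≤ C := by
  have huniq : UniqueDiffOn ℝ (Set.Icc (0 : ℝ) 1) := uniqueDiffOn_Icc zero_lt_one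
  have hiter : ∀ k, Set.EqOn (iteratedDerivWithin k (f 0) (Set.Icc 0 1)) (f k) (Set.Icc 0 1) := by
    intro k
    induction k with
    | zero => intro t _; simp
    | succ k ih =>
      intro t ht
      rw [iteratedDerivWithin_succ, derivWithin_congr ih (ih ht)]
      exact (hf k t ht).derivWithin (huniq t ht)
  have hcd : ContDiffOn ℝ ((n + 1 : ℕ) : ℕ∞) (f 0) (Set.Icc 0 1) :=
    contDiffOn_of_differentiableOn_deriv fun k _ t ht =>
      ((hf k t ht).congr (fun s hs => hiter k hs) (hiter k ht)).differentiableWithinAt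
  have h0 : (0 : ℝ) ∈ Set.Icc (0 : ℝ) 1 := ⟨le_rfl, zero_le_one⟩
  have h := taylor_mean_remainder_bound (n := n) (C := C) zero_le_one (by exact_mod_cast hcd)
    (Set.right_mem_Icc.2 zero_le_one) fun t ht => by rw [hiter _ ht]; exact hC t ht
  rw [taylor_within_apply] at h
  have hC0 : 0 ≤ C := (norm_nonneg _).trans (hC 0 h0)
  have hdiv : C * (1 - 0) ^ (n + 1) / (n ! : ℝ) ≤ C := by
    rw [sub_zero, one_pow, mul_one]
    exact div_le_self hC0 (by exact_mod_cast Nat.succ_le_of_lt n.factorial_pos)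
  refine le_trans (le_of_eq ?_) (h.trans hdiv)
  congr 2
  refine Finset.sum_congr rfl fun k _ => ?_
  rw [hiter k h0]
  simp

/-- Taylor's formula for a function of several variables. -/
theorem norm_map_add_sub_taylor_le {W : E → E} (hW : ContDiff ℝ ∞ W) {M : ℝ} {q : ℕ}
    (hM : ∀ y, ‖iteratedFDeriv ℝ (q + 1) W y‖ ≤ M) (x h : E) :
    ‖W (x + h) - ∑ k ∈ Finset.range (q + 1), (k ! : ℝ)⁻¹ • iteratedFDeriv ℝ k W x fun _ => h‖ ≤
      M * ‖h‖ ^ (q + 1) := by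
  have := norm_sub_taylor_le (n := q) (C := M * ‖h‖ ^ (q + 1))
    (f := fun k t => iteratedFDeriv ℝ k W (x + t • h) fun _ => h) (fun k t _ => ?_) fun t _ => ?_
  · simpa using this
  · have hd : DifferentiableAt ℝ (iteratedFDeriv ℝ k W) (x + t • h) :=
      (hW.differentiable_iteratedFDeriv (by exact_mod_cast WithTop.coe_lt_top k)) _
    have hline : HasDerivAt (fun s : ℝ => x + s • h) h t := by
      simpa using ((hasDerivAt_id t).smul_const h).const_add x
    have h1 := (hd.continuousMultilinear_apply_const fun _ => h).hasFDerivAt.comp_hasDerivAt t hline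
    exact (h1.congr_deriv
      (hd.iteratedFDeriv_succ_apply_left' (m := fun _ => h)).symm).hasDerivWithinAt
  · refine (ContinuousMultilinearMap.le_opNorm _ _).trans ?_
    rw [Finset.prod_const, Finset.card_univ, Fintype.card_fin]
    gcongr
    exact hM _

end Taylor

theorem SmoothBdd.norm_exp_sub_le {N : ℕ} (W : SmoothBdd N) {M : ℝ} {m : ℕ}
    (hM : ∀ k ≤ m, ∀ y, ‖iteratedFDeriv ℝ k W y‖ ≤ M) (x : EuclideanSpace ℝ (Fin N)) :
    ‖W.exp x - (x + ∑ t ∈ RTree.upTo m,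
      ((t.labellings : ℝ) / (t.order ! : ℝ)) • elemDiff W x t)‖ ≤
      (LTree.labelled (m + 1)).card * M ^ (m + 1) := by
  classical
  obtain ⟨z, hz⟩ := W.exists_solution x
  have h := norm_sub_taylor_le (n := m) (C := (LTree.labelled (m + 1)).card * M ^ (m + 1))
    -- The zeroth derivative is the solution itself, not a sum over trees; from order one on, the
    -- sum runs over labelled trees with as many vertices as derivatives.
    (f := fun k => Nat.casesOn k z fun k s =>
      ∑ u ∈ LTree.labelled (k + 1), elemDiff W (z s) u.shape) ?_ ?_
  · rw [Finset.sum_range_succ'] at h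
    simp only [Nat.factorial_zero, Nat.cast_one, inv_one, one_smul, hz.1] at h
    have hsum : ∑ t ∈ RTree.upTo m, ((t.labellings : ℝ) / (t.order ! : ℝ)) • elemDiff W x t =
        ∑ k ∈ Finset.range m, ((k + 1)! : ℝ)⁻¹ •
          ∑ u ∈ LTree.labelled (k + 1), elemDiff W x u.shape := by
      rw [← Finset.sum_fiberwise_of_maps_to (g := RTree.order) (t := Finset.range (m + 1))
        fun t ht => Finset.mem_range.2 (Nat.lt_succ_of_le (RTree.mem_upTo.1 ht)),
        Finset.sum_range_succ', Finset.sum_eq_zero (s := Finset.filter _ _), add_zero]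
      · refine Finset.sum_congr rfl fun k hk => ?_
        rw [LTree.sum_labelled_shape (m := m) (Finset.mem_range.1 hk), Finset.smul_sum]
        refine Finset.sum_congr rfl fun t ht => ?_
        rw [(Finset.mem_filter.1 ht).2, ← Nat.cast_smul_eq_nsmul ℝ, smul_smul, div_eq_inv_mul]
      · intro t ht
        exact absurd (Finset.mem_filter.1 ht).2 t.order_pos.ne'
    have h' : ‖z 1 - (_ + z 0)‖ ≤ _ := h
    rwa [hz.1, hz.eq_exp, add_comm, ← hsum] at h'
  · intro k t ht
    cases k with
    | zero =>
      refine (hz.2 t ht).congr_deriv ?_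
      simp [LTree.labelled_one, LTree.shape_singleVertex, elemDiff_node, multiDeriv_zero]
    | succ k =>
      have := HasDerivWithinAt.fun_sum (u := LTree.labelled (k + 1)) fun u hu =>
        LTree.hasDerivWithinAt_elemDiff_shape W.contDiff (hz.2 t ht) (u := u)
          (LTree.lt_of_mem_labelled hu)
      refine this.congr_deriv ?_
      exact (LTree.sum_labelled_succ (Nat.succ_le_succ (Nat.zero_le k))
        fun u => elemDiff W (z t) u.shape).symm
  · intro t _
    refine (norm_sum_le_of_le _ fun u hu => ?_).trans_eq (by rw [Finset.sum_const, nsmul_eq_mul])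
    have ho := LTree.order_shape_of_mem_labelled hu
    have := norm_elemDiff_le W.contDiff (fun k hk => hM k hk (z t)) u.shape ho.le
    rwa [ho] at this

/-! ### Substituting a tree expansion into the Taylor formula -/

section Substitution

variable {E : Type} [NormedAddCommGroup E] [NormedSpace ℝ E]

theorem iteratedFDeriv_sum_elemDiff {W : E → E} (hW : ContDiff ℝ ∞ W) (x : E) (S : Finset RTree)
    (c : RTree → ℝ) (k : ℕ) :
    (iteratedFDeriv ℝ k W x fun _ => ∑ t ∈ S, c t • elemDiff W x t) =
      ∑ f ∈ Fintype.piFinset fun _ : Fin k => S,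
        (∏ i, c (f i)) • elemDiff W x (RTree.node (Finset.univ.val.map f)) := by
  rw [ContinuousMultilinearMap.map_sum_finset _ (fun _ t => c t • elemDiff W x t) fun _ => S]
  refine Finset.sum_congr rfl fun f _ => ?_
  rw [ContinuousMultilinearMap.map_smul_univ, elemDiff_node, Multiset.map_map,
    ← multiDeriv_map_univ hW]
  rfl

open Classical in
/-- The coefficient of the tree `[t₁ ⋯ tₗ]` in the composition of `W` with a tree expansion with
coefficients `c`. -/
def graftCoeff (c : RTree → ℝ) (t : RTree) : ℝ :=
  (t.branches.map c).prod / ∏ t' ∈ t.branches.toFinset, ((t.branches.count t')! : ℝ)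

open Classical in
-- Group the tuples by the tree they graft to: a tree with k branches comes from k! / ∏ mᵢ! tuples,
-- which cancels `(k ! : ℝ)⁻¹`. No tree is lost, since one of order at most `q + 1` has at most `q`
-- branches, all of order at most `q`.
theorem sum_tuples_eq_sum_upTo (q : ℕ) (c : RTree → ℝ) (F : RTree → E) :
    ∑ k ∈ Finset.range (q + 1), (k ! : ℝ)⁻¹ •
      ∑ f ∈ (Fintype.piFinset fun _ : Fin k => RTree.upTo q).filter
        (fun f => (RTree.node (Finset.univ.val.map f)).order ≤ q + 1),
        (∏ i, c (f i)) • F (RTree.node (Finset.univ.val.map f)) =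
      ∑ t ∈ RTree.upTo (q + 1), graftCoeff c t • F t := by
  rw [← Finset.sum_fiberwise_of_maps_to (s := RTree.upTo (q + 1))
    (g := fun t : RTree => t.branches.card) (t := Finset.range (q + 1)) fun t ht =>
      Finset.mem_range.2 (t.card_branches_lt_order.trans_le (RTree.mem_upTo.1 ht))]
  refine Finset.sum_congr rfl fun k _ => ?_
  rw [Finset.smul_sum, ← Finset.sum_fiberwise_of_maps_to
    (g := fun f : Fin k → RTree => RTree.node (Finset.univ.val.map f))
    (t := (RTree.upTo (q + 1)).filter fun t => t.branches.card = k)]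
  · refine Finset.sum_congr rfl fun t ht => ?_
    obtain ⟨htq, hk⟩ := Finset.mem_filter.1 ht
    rw [RTree.mem_upTo] at htq
    have hmem : ∀ t' ∈ t.branches, t' ∈ RTree.upTo q := fun t' h => by
      have := RTree.order_lt_of_mem_branches h
      exact RTree.mem_upTo.2 (by omega)
    have hnode : ∀ f : Fin k → RTree, RTree.node (Finset.univ.val.map f) = t ↔
        Finset.univ.val.map f = t.branches := fun f =>
      ⟨fun h => by rw [← h, RTree.branches_node], fun h => by rw [h, RTree.node_branches]⟩
    have hset : (((Fintype.piFinset fun _ : Fin k => RTree.upTo q).filter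
        fun f => (RTree.node (Finset.univ.val.map f)).order ≤ q + 1).filter
          fun f => RTree.node (Finset.univ.val.map f) = t) =
        (Fintype.piFinset fun _ : Fin k => RTree.upTo q).filter
          fun f => Finset.univ.val.map f = t.branches := by
      ext f
      simp only [Finset.mem_filter, hnode]
      refine ⟨fun h => ⟨h.1.1, h.2⟩, fun h => ⟨⟨h.1, ?_⟩, h.2⟩⟩
      rwa [(hnode f).2 h.2]
    have hcount := card_tuples_mul_prod_factorial hk hmem
    rw [hset, Finset.sum_congr rfl (g := fun _ => (k ! : ℝ)⁻¹ • (t.branches.map c).prod • F t)]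
    · rw [Finset.sum_const, ← Nat.cast_smul_eq_nsmul ℝ, smul_smul, smul_smul, graftCoeff]
      congr 1
      have hP : (∏ t' ∈ t.branches.toFinset, ((t.branches.count t')! : ℝ)) ≠ 0 :=
        Finset.prod_ne_zero_iff.2 fun t' _ => by exact_mod_cast (Nat.factorial_pos _).ne'
      have hcount' := congrArg (Nat.cast (R := ℝ)) hcount
      push_cast at hcount'
      have hk0 : (k ! : ℝ) ≠ 0 := by exact_mod_cast (Nat.factorial_pos _).ne'
      rw [eq_div_iff hP, ← hcount']
      rw [← hcount'] at hk0
      have hN := left_ne_zero_of_mul hk0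
      field_simp
    · intro f hf
      have hf := (Finset.mem_filter.1 hf).2
      rw [(hnode f).2 hf, ← hf, Multiset.map_map]
      rfl
  · intro f hf
    obtain ⟨-, hf⟩ := Finset.mem_filter.1 hf
    refine Finset.mem_filter.2 ⟨RTree.mem_upTo.2 hf, ?_⟩
    rw [RTree.branches_node]
    simp

/-- If `h` has a tree expansion with coefficients `c` up to order `q`, then `W(x + h)` has the
tree expansion with coefficients `graftCoeff c` up to order `q + 1`. -/
theorem exists_norm_map_add_sub_le (q : ℕ) {B C : ℝ} (hB : 0 ≤ B) (hC : 0 ≤ C) :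
    ∃ C' : ℝ, 0 ≤ C' ∧ ∀ {W : E → E} (_ : ContDiff ℝ ∞ W) {M : ℝ} (_ : M ≤ 1)
      (_ : ∀ k ≤ q + 1, ∀ y, ‖iteratedFDeriv ℝ k W y‖ ≤ M) (x h : E) (c : RTree → ℝ)
      (_ : ∀ t ∈ RTree.upTo q, |c t| ≤ B)
      (_ : ‖h - ∑ t ∈ RTree.upTo q, c t • elemDiff W x t‖ ≤ C * M ^ (q + 1)),
      ‖W (x + h) - ∑ t ∈ RTree.upTo (q + 1), graftCoeff c t • elemDiff W x t‖ ≤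
        C' * M ^ (q + 2) := by
  classical
  set n : ℝ := ((RTree.upTo q).card : ℝ)
  have hn0 : 0 ≤ n := Nat.cast_nonneg _
  set H : ℝ := C + n * B
  have hH0 : 0 ≤ H := by positivity
  -- The three summands bound the Taylor remainder, the replacement of `h` by its tree expansion,
  -- and the tuples that graft to trees of order above `q + 1`. Here `H * M` bounds both `h` and its
  -- expansion.
  refine ⟨H ^ (q + 1) + ∑ k ∈ Finset.range (q + 1), k * H ^ (k - 1) * C +
    ∑ k ∈ Finset.range (q + 1), n ^ k * B ^ k, by positivity, ?_⟩
  intro W hW M hM1 hM x h c hc hh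
  have hM0 : 0 ≤ M := (norm_nonneg _).trans (hM 0 (Nat.zero_le _) x)
  set hq : E := ∑ t ∈ RTree.upTo q, c t • elemDiff W x t
  have hF : ∀ t ∈ RTree.upTo q, ‖elemDiff W x t‖ ≤ M ^ t.order := fun t ht =>
    norm_elemDiff_le hW (fun k hk => hM k hk x) t (by have := RTree.mem_upTo.1 ht; omega)
  have hq_le' : ‖hq‖ ≤ n * B * M := by
    refine (norm_sum_le_of_le (n := fun _ => B * M) _ fun t ht => ?_).trans_eq
      (by rw [Finset.sum_const, nsmul_eq_mul, mul_assoc])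
    rw [norm_smul]
    gcongr
    · exact hc t ht
    · exact (hF t ht).trans (pow_le_of_le_one hM0 hM1 t.order_pos.ne')
  have hq_le : ‖hq‖ ≤ H * M := hq_le'.trans (by gcongr; linarith)
  have hh' : ‖h - hq‖ ≤ C * M := hh.trans (by
    gcongr
    exact pow_le_of_le_one hM0 hM1 (Nat.succ_ne_zero q))
  have h_le : ‖h‖ ≤ H * M := by
    have h1 : ‖h‖ ≤ ‖h - hq‖ + ‖hq‖ := by simpa using norm_add_le (h - hq) hq
    calc ‖h‖ ≤ C * M + n * B * M := h1.trans (add_le_add hh' hq_le')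
      _ = H * M := (add_mul _ _ _).symm
  have htaylor : ‖W (x + h) - ∑ k ∈ Finset.range (q + 1),
      (k ! : ℝ)⁻¹ • iteratedFDeriv ℝ k W x fun _ => h‖ ≤ H ^ (q + 1) * M ^ (q + 2) := by
    refine (norm_map_add_sub_taylor_le hW (hM (q + 1) le_rfl) x h).trans ?_
    calc M * ‖h‖ ^ (q + 1) ≤ M * (H * M) ^ (q + 1) := by gcongr
      _ = H ^ (q + 1) * M ^ (q + 2) := by ring
  have hinv : ∀ k : ℕ, ‖((k ! : ℝ)⁻¹)‖ ≤ 1 := fun k => by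
    rw [norm_inv, Real.norm_natCast]
    exact inv_le_one_of_one_le₀ (by exact_mod_cast Nat.succ_le_of_lt k.factorial_pos)
  have hsubst : ∀ k ∈ Finset.range (q + 1), ‖(k ! : ℝ)⁻¹ • ((iteratedFDeriv ℝ k W x fun _ => h) -
      iteratedFDeriv ℝ k W x fun _ => hq)‖ ≤ k * H ^ (k - 1) * C * M ^ (q + 2) := by
    intro k hk
    have hkq := Finset.mem_range.1 hk
    rw [norm_smul]
    refine (mul_le_of_le_one_left (norm_nonneg _) (hinv k)).trans ?_
    refine (ContinuousMultilinearMap.norm_image_sub_le _ _ _).trans ?_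
    rw [Fintype.card_fin]
    have h1 : max ‖(fun _ : Fin k => h)‖ ‖(fun _ : Fin k => hq)‖ ≤ H * M :=
      max_le ((pi_norm_const_le h).trans h_le) ((pi_norm_const_le hq).trans hq_le)
    have h2 : ‖(fun _ : Fin k => h) - fun _ => hq‖ ≤ C * M ^ (q + 1) :=
      (pi_norm_const_le (h - hq)).trans hh
    -- The derivative of `W` gives one power of `M` and the error of `h` gives `q + 1`; the powers
    -- from the remaining arguments can be discarded because `M ≤ 1`.
    calc _ ≤ M * k * (H * 1) ^ (k - 1) * (C * M ^ (q + 1)) := by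
          gcongr
          · exact hM k (by omega) x
          · exact h1.trans (by gcongr)
      _ = k * H ^ (k - 1) * C * M ^ (q + 2) := by
          rw [mul_one]
          ring
  have htail : ∀ k ∈ Finset.range (q + 1), ‖(k ! : ℝ)⁻¹ • ∑ f ∈ (Fintype.piFinset fun _ : Fin k =>
      RTree.upTo q).filter (fun f => ¬ (RTree.node (Finset.univ.val.map f)).order ≤ q + 1),
      (∏ i, c (f i)) • elemDiff W x (RTree.node (Finset.univ.val.map f))‖ ≤
        n ^ k * B ^ k * M ^ (q + 2) := by
    intro k hk
    have hkq := Finset.mem_range.1 hk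
    rw [norm_smul]
    refine (mul_le_of_le_one_left (norm_nonneg _) (hinv k)).trans ?_
    refine (norm_sum_le_of_le (n := fun _ => B ^ k * M ^ (q + 2)) _ fun f hf => ?_).trans ?_
    · obtain ⟨hf, hord⟩ := Finset.mem_filter.1 hf
      rw [Fintype.mem_piFinset] at hf
      rw [norm_smul, norm_prod]
      gcongr
      · refine (Finset.prod_le_prod (g := fun _ => B) (fun _ _ => norm_nonneg _)
          fun i _ => hc _ (hf i)).trans_eq (by simp)
      · refine (norm_elemDiff_node_le hW (M := M) (hM _ (by simp; omega) x) fun t ht => ?_).trans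
          (pow_le_pow_of_le_one hM0 hM1 (by omega))
        obtain ⟨i, -, rfl⟩ := Multiset.mem_map.1 ht
        exact hF _ (hf i)
    · rw [Finset.sum_const, nsmul_eq_mul, mul_assoc]
      gcongr
      refine (Nat.cast_le.2 (Finset.card_filter_le _ _)).trans_eq ?_
      rw [Fintype.card_piFinset_const, Nat.cast_pow]
  rw [← sum_tuples_eq_sum_upTo]
  have hsplit : ∀ k : ℕ, (iteratedFDeriv ℝ k W x fun _ => hq) = _ := fun k =>
    (iteratedFDeriv_sum_elemDiff hW x (RTree.upTo q) c k).trans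
      (Finset.sum_filter_add_sum_filter_not _
        (fun f => (RTree.node (Finset.univ.val.map f)).order ≤ q + 1) _).symm
  calc _ = ‖(W (x + h) - ∑ k ∈ Finset.range (q + 1),
          (k ! : ℝ)⁻¹ • iteratedFDeriv ℝ k W x fun _ => h) +
        ∑ k ∈ Finset.range (q + 1), (k ! : ℝ)⁻¹ • ((iteratedFDeriv ℝ k W x fun _ => h) -
          iteratedFDeriv ℝ k W x fun _ => hq) +
        ∑ k ∈ Finset.range (q + 1), (k ! : ℝ)⁻¹ • ∑ f ∈ (Fintype.piFinset fun _ : Fin k =>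
          RTree.upTo q).filter (fun f => ¬ (RTree.node (Finset.univ.val.map f)).order ≤ q + 1),
          (∏ i, c (f i)) • elemDiff W x (RTree.node (Finset.univ.val.map f))‖ := by
        congr 1
        simp only [hsplit, smul_sub, smul_add, Finset.sum_sub_distrib, Finset.sum_add_distrib]
        abel
    _ ≤ H ^ (q + 1) * M ^ (q + 2) + ∑ k ∈ Finset.range (q + 1), k * H ^ (k - 1) * C * M ^ (q + 2) +
        ∑ k ∈ Finset.range (q + 1), n ^ k * B ^ k * M ^ (q + 2) :=
      norm_add_le_of_le (norm_add_le_of_le htaylor (norm_sum_le_of_le _ hsubst))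
        (norm_sum_le_of_le _ htail)
    _ = _ := by simp only [add_mul, Finset.sum_mul]

end Substitution

/-! ### Tree expansion of the Runge–Kutta method -/

section RungeKutta

variable {E : Type} [NormedAddCommGroup E] [NormedSpace ℝ E] {K : ℕ}

/-- The multiplicity factorials of grafting and the symmetries of the branches multiply to σ(t), by
its recursion. -/
theorem graftCoeff_weight_div_symmetry (A : Matrix (Fin K) (Fin K) ℝ) (j : Fin K) (t : RTree) :
    graftCoeff (fun t => t.weight A j / t.symmetry) t =
      (t.branches.map fun s => s.weight A j).prod / t.symmetry := by
  classical
  conv_rhs => rw [← RTree.node_branches t, RTree.symmetry_eq, RTree.branches_node]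
  rw [graftCoeff, Multiset.prod_map_div, div_div, mul_comm]

theorem weight_eq (A : Matrix (Fin K) (Fin K) ℝ) (i : Fin K) (t : RTree) :
    t.weight A i = ∑ j, A i j * (t.branches.map fun s => s.weight A j).prod := by
  conv_lhs => rw [← RTree.node_branches t]
  exact RTree.weight_node A _ i

/-- A tree expansion of a stage up to order `q` yields one of `W` at that stage up to order
`q + 1`. -/
theorem exists_norm_stage_value_sub_le_of_stage (A : Matrix (Fin K) (Fin K) ℝ) (q : ℕ) {C : ℝ}
    (hC : 0 ≤ C) : ∃ C' : ℝ, 0 ≤ C' ∧ ∀ {W : E → E} (_ : ContDiff ℝ ∞ W) {M : ℝ} (_ : M ≤ 1)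
      (_ : ∀ k ≤ q + 1, ∀ y, ‖iteratedFDeriv ℝ k W y‖ ≤ M) (x y : E) (j : Fin K)
      (_ : ‖y - x - ∑ t ∈ RTree.upTo q, (t.weight A j / t.symmetry) • elemDiff W x t‖ ≤
        C * M ^ (q + 1)),
      ‖W y - ∑ t ∈ RTree.upTo (q + 1),
        ((t.branches.map fun s => s.weight A j).prod / t.symmetry) • elemDiff W x t‖ ≤
        C' * M ^ (q + 2) := by
  -- A bound common to all trees and stages, so that the constant depends on neither `j` nor `W`.
  have hB : ∀ t ∈ RTree.upTo q, ∀ j, |t.weight A j / t.symmetry| ≤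
      ∑ t ∈ RTree.upTo q, ∑ j, |t.weight A j / t.symmetry| := fun t ht j =>
    (Finset.single_le_sum (f := fun j => |t.weight A j / t.symmetry|)
      (fun _ _ => abs_nonneg _) (Finset.mem_univ j)).trans
      (Finset.single_le_sum (f := fun t : RTree => ∑ j, |t.weight A j / t.symmetry|)
        (fun _ _ => Finset.sum_nonneg fun _ _ => abs_nonneg _) ht)
  obtain ⟨C', hC', h⟩ := exists_norm_map_add_sub_le (E := E) q
    (Finset.sum_nonneg fun t (_ : t ∈ RTree.upTo q) => Finset.sum_nonneg
      fun j (_ : j ∈ Finset.univ) => abs_nonneg (t.weight A j / t.symmetry)) hC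
  refine ⟨C', hC', fun hW M hM1 hM x y j hy => ?_⟩
  have := h hW hM1 hM x (y - x) (fun t => t.weight A j / t.symmetry) (fun t ht => hB t ht j) hy
  simpa only [graftCoeff_weight_div_symmetry, add_sub_cancel] using this

/-- Bootstrap in `q`: the stage equations convert an expansion of `W` at the stages into one of the
stages of the same order, and composition with `W` gains one order. Any solution `Y` is allowed,
because the case `q = 0` uses only that `W` is bounded by `M`. -/
theorem exists_norm_stage_sub_le (A : Matrix (Fin K) (Fin K) ℝ) (q : ℕ) :
    ∃ C : ℝ, 0 ≤ C ∧ ∀ {W : E → E} (_ : ContDiff ℝ ∞ W) {M : ℝ} (_ : M ≤ 1)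
      (_ : ∀ k ≤ q, ∀ y, ‖iteratedFDeriv ℝ k W y‖ ≤ M) (x : E) (Y : Fin K → E)
      (_ : ∀ i, Y i = x + ∑ j, A i j • W (Y j)) (i : Fin K),
      ‖Y i - x - ∑ t ∈ RTree.upTo q, (t.weight A i / t.symmetry) • elemDiff W x t‖ ≤
        C * M ^ (q + 1) := by
  have hA : ∀ i, ∑ j, |A i j| ≤ ∑ i, ∑ j, |A i j| := fun i =>
    Finset.single_le_sum (f := fun i => ∑ j, |A i j|)
      (fun _ _ => Finset.sum_nonneg fun _ _ => abs_nonneg _) (Finset.mem_univ i)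
  have hA0 : 0 ≤ ∑ i, ∑ j, |A i j| :=
    Finset.sum_nonneg fun _ _ => Finset.sum_nonneg fun _ _ => abs_nonneg _
  have hcomb : ∀ (v : Fin K → E) (r : ℝ), 0 ≤ r → (∀ j, ‖v j‖ ≤ r) → ∀ i,
      ‖∑ j, A i j • v j‖ ≤ (∑ i, ∑ j, |A i j|) * r := fun v r hr hv i => by
    refine (norm_sum_le_of_le (n := fun j => |A i j| * r) _ fun j _ => ?_).trans ?_
    · rw [norm_smul, Real.norm_eq_abs]
      gcongr
      exact hv j
    · rw [← Finset.sum_mul]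
      exact mul_le_mul_of_nonneg_right (hA i) hr
  induction q with
  | zero =>
    refine ⟨_, hA0, fun {W} hW M hM1 hM x Y hY i => ?_⟩
    have hW0 : ∀ y, ‖W y‖ ≤ M := fun y => by
      simpa only [norm_iteratedFDeriv_zero] using hM 0 le_rfl y
    rw [RTree.upTo_zero, Finset.sum_empty, sub_zero, hY i, add_sub_cancel_left, zero_add, pow_one]
    exact hcomb _ M ((norm_nonneg _).trans (hW0 x)) (fun j => hW0 (Y j)) i
  | succ q ih =>
    obtain ⟨C, hC, ih⟩ := ih
    obtain ⟨C', hC', hval⟩ := exists_norm_stage_value_sub_le_of_stage (E := E) A q hC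
    refine ⟨_, mul_nonneg hA0 hC', fun {W} hW M hM1 hM x Y hY i => ?_⟩
    have hM0 : 0 ≤ M := (norm_nonneg _).trans (hM 0 (Nat.zero_le _) x)
    have hstage := ih hW hM1 (fun k hk => hM k (hk.trans (Nat.le_succ q))) x Y hY
    have hv := fun j => hval hW hM1 hM x (Y j) j (hstage j)
    -- The recursion of the weights has the same form as the stage equation, so the stage error is
    -- the `A`-combination of the errors of `W (Y j)`.
    have hexp : Y i - x - ∑ t ∈ RTree.upTo (q + 1), (t.weight A i / t.symmetry) • elemDiff W x t =
        ∑ j, A i j • (W (Y j) - ∑ t ∈ RTree.upTo (q + 1),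
          ((t.branches.map fun s => s.weight A j).prod / t.symmetry) • elemDiff W x t) := by
      simp only [smul_sub, Finset.sum_sub_distrib, Finset.smul_sum]
      rw [Finset.sum_comm]
      congr 1
      · rw [hY i, add_sub_cancel_left]
      · refine Finset.sum_congr rfl fun t _ => ?_
        rw [weight_eq, Finset.sum_div, Finset.sum_smul]
        refine Finset.sum_congr rfl fun j _ => ?_
        rw [smul_smul, mul_div_assoc]
    rw [hexp, mul_assoc]
    exact hcomb _ _ (mul_nonneg hC' (pow_nonneg hM0 _)) hv i

/-- Weighted with `b`, these coefficients become the right-hand sides of the order conditions. -/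
theorem exists_norm_stage_value_sub_le (A : Matrix (Fin K) (Fin K) ℝ) (q : ℕ) :
    ∃ C : ℝ, 0 ≤ C ∧ ∀ {W : E → E} (_ : ContDiff ℝ ∞ W) {M : ℝ} (_ : M ≤ 1)
      (_ : ∀ k ≤ q + 1, ∀ y, ‖iteratedFDeriv ℝ k W y‖ ≤ M) (x : E) (Y : Fin K → E)
      (_ : ∀ i, Y i = x + ∑ j, A i j • W (Y j)) (j : Fin K),
      ‖W (Y j) - ∑ t ∈ RTree.upTo (q + 1),
        ((t.branches.map fun s => s.weight A j).prod / t.symmetry) • elemDiff W x t‖ ≤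
        C * M ^ (q + 2) := by
  obtain ⟨C, hC, hstage⟩ := exists_norm_stage_sub_le (E := E) A q
  obtain ⟨C', hC', hval⟩ := exists_norm_stage_value_sub_le_of_stage (E := E) A q hC
  exact ⟨C', hC', fun hW M hM1 hM x Y hY j => hval hW hM1 hM x (Y j) j
    (hstage hW hM1 (fun k hk => hM k (hk.trans (Nat.le_succ q))) x Y hY j)⟩

end RungeKutta

/-! ### The `C^n` norm -/

namespace SmoothBdd

variable {N : ℕ} (W : SmoothBdd N)

theorem derivNorm_nonneg (n : ℕ) : 0 ≤ W.derivNorm n := by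
  refine Real.sSup_nonneg ?_
  rintro _ ⟨x, U, -, rfl⟩
  exact norm_nonneg _

theorem norm_iteratedFDeriv_apply_le_derivNorm {n : ℕ} (x : EuclideanSpace ℝ (Fin N))
    {U : Fin n → EuclideanSpace ℝ (Fin N)} (hU : ∀ i, ‖U i‖ = 1) :
    ‖iteratedFDeriv ℝ n W x U‖ ≤ W.derivNorm n := by
  obtain ⟨C, hC⟩ := W.bounded n
  refine le_csSup ⟨C, ?_⟩ ⟨x, U, hU, rfl⟩
  rintro _ ⟨y, V, hV, rfl⟩
  refine (ContinuousMultilinearMap.le_opNorm _ _).trans ?_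
  simpa [hV] using hC y

/-- Homogeneity reduces to unit directions, and a zero direction gives zero. This covers `N = 0`,
where no unit vector exists. -/
theorem norm_iteratedFDeriv_le_derivNorm (n : ℕ) (x : EuclideanSpace ℝ (Fin N)) :
    ‖iteratedFDeriv ℝ n W x‖ ≤ W.derivNorm n := by
  refine ContinuousMultilinearMap.opNorm_le_bound (W.derivNorm_nonneg n) fun U => ?_
  by_cases h0 : ∃ i, U i = 0
  · obtain ⟨i, hi⟩ := h0
    rw [ContinuousMultilinearMap.map_coord_zero _ i hi, norm_zero]
    exact mul_nonneg (W.derivNorm_nonneg n) (Finset.prod_nonneg fun _ _ => norm_nonneg _)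
  · push Not at h0
    have hU : U = fun i => ‖U i‖ • (‖U i‖⁻¹ • U i) := funext fun i => by
      rw [smul_inv_smul₀ (norm_ne_zero_iff.2 (h0 i))]
    conv_lhs => rw [hU, ContinuousMultilinearMap.map_smul_univ]
    rw [norm_smul, mul_comm, norm_prod]
    simp only [norm_norm]
    gcongr
    refine W.norm_iteratedFDeriv_apply_le_derivNorm x fun i => ?_
    rw [norm_smul, norm_inv, norm_norm, inv_mul_cancel₀ (norm_ne_zero_iff.2 (h0 i))]

theorem norm_iteratedFDeriv_le_cNorm {n k : ℕ} (hk : k ≤ n) (x : EuclideanSpace ℝ (Fin N)) :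
    ‖iteratedFDeriv ℝ k W x‖ ≤ W.cNorm n :=
  (W.norm_iteratedFDeriv_le_derivNorm k x).trans
    (Finset.single_le_sum (f := W.derivNorm) (fun i _ => W.derivNorm_nonneg i)
      (Finset.mem_range.2 (Nat.lt_succ_of_le hk)))

theorem norm_le_cNorm (n : ℕ) (x : EuclideanSpace ℝ (Fin N)) : ‖W x‖ ≤ W.cNorm n := by
  simpa only [norm_iteratedFDeriv_zero] using W.norm_iteratedFDeriv_le_cNorm (Nat.zero_le n) x

theorem norm_exp_sub_self_le (n : ℕ) (x : EuclideanSpace ℝ (Fin N)) :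
    ‖W.exp x - x‖ ≤ W.cNorm n := by
  have h := W.norm_exp_sub_le (M := W.cNorm n) (m := 0)
    (fun k hk y => W.norm_iteratedFDeriv_le_cNorm (hk.trans (Nat.zero_le n)) y) x
  simpa [RTree.upTo_zero, LTree.labelled_one] using h

end SmoothBdd

/-! ### The local error of the Runge–Kutta method -/

/-- The crude estimate, free of order conditions: each increment is at most a constant times the sup
norm of `W`. It settles `m = 0` and fields of large norm. -/
theorem norm_rungeKutta_sub_exp_le {N K : ℕ} {A : Matrix (Fin K) (Fin K) ℝ} {b : Fin K → ℝ}
    {W : SmoothBdd N} {x y : EuclideanSpace ℝ (Fin N)} (h : IsRungeKuttaValue A b W 1 x y) (n : ℕ) :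
    ‖y - W.exp x‖ ≤ (∑ i, |b i| + 1) * W.cNorm n := by
  obtain ⟨Y, -, rfl⟩ := h
  have h1 : ‖∑ i, b i • W (Y i)‖ ≤ (∑ i, |b i|) * W.cNorm n := by
    rw [Finset.sum_mul]
    refine norm_sum_le_of_le _ fun i _ => ?_
    rw [norm_smul, Real.norm_eq_abs]
    gcongr
    exact W.norm_le_cNorm n _
  rw [one_smul, add_mul, one_mul, show x + ∑ i, b i • W (Y i) - W.exp x =
    ∑ i, b i • W (Y i) - (W.exp x - x) by abel]
  exact norm_sub_le_of_le h1 (W.norm_exp_sub_self_le n x)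

theorem exists_norm_rungeKutta_sub_exp_le {N K : ℕ} (q : ℕ) {A : Matrix (Fin K) (Fin K) ℝ}
    {b : Fin K → ℝ} (hAb : OrderConditions (q + 1) A b) :
    ∃ C : ℝ, 0 ≤ C ∧ ∀ (W : SmoothBdd N) (x y : EuclideanSpace ℝ (Fin N)),
      IsRungeKuttaValue A b W 1 x y → W.cNorm (q + 2) ≤ 1 →
      ‖y - W.exp x‖ ≤ C * W.cNorm (q + 2) ^ (q + 2) := by
  obtain ⟨C, hC, hval⟩ := exists_norm_stage_value_sub_le (E := EuclideanSpace ℝ (Fin N)) A q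
  refine ⟨(∑ i, |b i|) * C + (LTree.labelled (q + 2)).card, by positivity, ?_⟩
  rintro W x _ ⟨Y, hY, rfl⟩ hM1
  set M := W.cNorm (q + 2)
  have hM : ∀ k ≤ q + 1, ∀ y, ‖iteratedFDeriv ℝ k W y‖ ≤ M := fun k hk y =>
    W.norm_iteratedFDeriv_le_cNorm (hk.trans (Nat.le_succ _)) y
  have hv := hval W.contDiff hM1 hM x Y (fun i => by simpa using hY i)
  have hexp := W.norm_exp_sub_le hM x
  have h1 : ‖∑ i, b i • (W (Y i) - ∑ t ∈ RTree.upTo (q + 1),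
      ((t.branches.map fun s => s.weight A i).prod / t.symmetry) • elemDiff W x t)‖ ≤
      (∑ i, |b i|) * C * M ^ (q + 2) := by
    rw [mul_assoc, Finset.sum_mul]
    refine norm_sum_le_of_le _ fun i _ => ?_
    rw [norm_smul, Real.norm_eq_abs]
    gcongr
    exact hv i
  -- The only use of the order conditions: the two tree expansions have the same coefficients.
  have hcond : ∑ i, b i • ∑ t ∈ RTree.upTo (q + 1),
      ((t.branches.map fun s => s.weight A i).prod / t.symmetry) • elemDiff W x t =
      ∑ t ∈ RTree.upTo (q + 1), ((t.labellings : ℝ) / (t.order ! : ℝ)) • elemDiff W x t := by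
    simp only [Finset.smul_sum]
    rw [Finset.sum_comm]
    refine Finset.sum_congr rfl fun t ht => ?_
    rw [hAb t (RTree.mem_upTo.1 ht), Finset.sum_div, Finset.sum_smul]
    refine Finset.sum_congr rfl fun i _ => ?_
    rw [smul_smul, mul_div_assoc]
  have hsplit : x + (1 : ℝ) • ∑ i, b i • W (Y i) - W.exp x =
      (∑ i, b i • (W (Y i) - ∑ t ∈ RTree.upTo (q + 1),
        ((t.branches.map fun s => s.weight A i).prod / t.symmetry) • elemDiff W x t)) -
      (W.exp x - (x + ∑ t ∈ RTree.upTo (q + 1),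
        ((t.labellings : ℝ) / (t.order ! : ℝ)) • elemDiff W x t)) := by
    rw [← hcond]
    simp only [smul_sub, Finset.sum_sub_distrib, one_smul]
    abel
  rw [hsplit, add_mul]
  exact norm_sub_le_of_le h1 hexp

end RK

end

theorem theorem4 {N K : ℕ} (m : ℕ) (A : Matrix (Fin K) (Fin K) ℝ) (b : Fin K → ℝ)
    (hAb : RK.OrderConditions m A b)
    (g : RK.SmoothBdd N → EuclideanSpace ℝ (Fin N) → EuclideanSpace ℝ (Fin N))
    (hg : ∀ (W : RK.SmoothBdd N) (y₀ : EuclideanSpace ℝ (Fin N)),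
      RK.IsRungeKuttaValue A b W 1 y₀ (g W y₀)) :
    RK.IsIntegrationScheme m g := by
  have hb : 0 ≤ ∑ i, |b i| := Finset.sum_nonneg fun _ _ => abs_nonneg _
  cases m with
  | zero =>
    refine ⟨∑ i, |b i| + 1, by positivity, fun W x => ?_⟩
    simpa using RK.norm_rungeKutta_sub_exp_le (hg W x) 1
  | succ q =>
    obtain ⟨C, hC, h⟩ := RK.exists_norm_rungeKutta_sub_exp_le (N := N) q hAb
    refine ⟨C + (∑ i, |b i| + 1), by positivity, fun W x => ?_⟩
    have hM0 : 0 ≤ W.cNorm (q + 2) := (norm_nonneg _).trans (W.norm_le_cNorm (q + 2) x)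
    -- The expansions need norm at most 1; above 1 the linear bound is dominated by the power `q +
    -- 2`.
    rcases le_total (W.cNorm (q + 2)) 1 with hM1 | hM1
    · refine (h W x _ (hg W x) hM1).trans ?_
      gcongr
      linarith
    · refine (RK.norm_rungeKutta_sub_exp_le (hg W x) (q + 2)).trans ?_
      exact mul_le_mul (by linarith) (le_self_pow₀ hM1 (Nat.succ_ne_zero _)) hM0 (by positivity)
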